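/- Let $\mathcal X\subseteq\mathbb R^d$, let $P,Q$ be Borel probability measures on $\mathcal X$, and let $(X_t)_{t\ge1}$ and $(Y_s)_{s\ge1}$ be independent sequences of i.i.d. random variables with laws $P$ and $Q$, respectively, on a probability space $(\Omega,\mathcal F,\mathbb P)$. Let $P_t=\frac1t\sum_{i=1}^t\delta_{X_i}$ and $Q_s=\frac1s\sum_{j=1}^s\delta_{Y_j}$ be the empirical measures. Let $c:\mathcal X\times\mathcal X\to[0,\infty)$ be a lower semicontinuous cost function bounded above by $\Delta<\infty$, and let $$\mathcal T_c(\mu,\nu)=\inf_{\pi\in\Pi(\mu,\nu)}\int c(x,y)\,d\pi(x,y)$$ be the optimal transport cost, where $\Pi(\mu,\nu)$ is the set of couplings of $\mu$ and $\nu$. Let $(\alpha_{c,ts})_{t,s\ge1}$ be real numbers such that $$\mathbb E\big[\mathcal T_c(P_t,Q_s)\big]-\mathcal T_c(P,Q)\le\alpha_{c,ts}\qquad\text{for all integers }t,s\ge1.$$ Let $\ell,g:[0,\infty)\to[1,\infty)$ be nondecreasing functions such that $$\sum_{k=1}^\infty\frac1{\ell(k)}\le1,\qquad \sum_{j,k=1}^\infty\frac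 e{g(j+k)}\le1,$$ with $\ell(x)=\ell(1)$ for $x\in[0,1]$ and $g(x)=g(2)$ for $x\in[0,2]$. Write $\bar t=\lceil t/2\rceil$ and, for $\delta\in(0,1)$, $$\kappa_t=\sqrt{\frac{\log\ell(\log_2t)+\log(4/\delta)}t},\qquad \kappa_{ts}=\kappa_t+\kappa_s.$$ Then, for any $\delta\in(0,1)$, with probability at least $1-\delta$, simultaneously for all integers $t,s\ge1$, $$-\alpha_{c,\bar t\bar s}-2\Delta\sqrt{\frac{t+s}{ts}\Big[\log g(\log_2t+\log_2s)+\log(2/\delta)\Big]}\;\le\;\mathcal T_c(P,Q)-\mathcal T_c(P_t,Q_s)\;\le\;\Delta\,\kappa_{ts}.$$ -/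

import Mathlib

open MeasureTheory ProbabilityTheory
open scoped NNReal ENNReal

/-- The set of couplings of `P` and `Q`: measures on the product space with first marginal `P` and
second marginal `Q` (such a measure is a probability measure as soon as `P` or `Q` is one). -/
def couplings {α : Type*} [MeasurableSpace α] (P Q : Measure α) : Set (Measure (α × α)) :=
  {π | π.map Prod.fst = P ∧ π.map Prod.snd = Q}

/-- The optimal transport cost, as an extended nonnegative number: the infimum of
`∫ c(x,y) dπ(x,y)` over all couplings `π` of `P` and `Q`. -/
noncomputable def otCost {α : Type*} [MeasurableSpace α] (c : α → α → ℝ≥0)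
    (P Q : Measure α) : ℝ≥0∞ :=
  ⨅ π ∈ couplings P Q, ∫⁻ z, (c z.1 z.2 : ℝ≥0∞) ∂π

/-- The empirical measure `(1/t) ∑ δ_{x_i}` of the first `t` terms `x 0, …, x (t - 1)` of a
sequence (meaningful for `t ≥ 1`). -/
noncomputable def empMeasure {α : Type*} [MeasurableSpace α] (x : ℕ → α) (t : ℕ) : Measure α :=
  (t : ℝ≥0∞)⁻¹ • ∑ i ∈ Finset.range t, Measure.dirac (x i)

/-- One-sample stitching functions `ℓ : [0,∞) → [1,∞)` with `∑_{k ≥ 1} 1/ℓ(k) ≤ 1`, constant on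
`[0,1]` and nondecreasing. Only the values on `[0,∞)` matter. -/
structure IsStitchingOne (l : ℝ → ℝ) : Prop where
  one_le : ∀ x, 0 ≤ x → 1 ≤ l x
  const : ∀ x, 0 ≤ x → x ≤ 1 → l x = l 1
  mono : MonotoneOn l (Set.Ici 0)
  sum_le : ∑' k : ℕ, ENNReal.ofReal (1 / l ((k : ℝ) + 1)) ≤ 1

/-- Two-sample stitching functions `g : [0,∞) → [1,∞)` with `∑_{j,k ≥ 1} e/g(j+k) ≤ 1`, constant
on `[0,2]` and nondecreasing. Only the values on `[0,∞)` matter. -/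
structure IsStitchingTwo (g : ℝ → ℝ) : Prop where
  one_le : ∀ x, 0 ≤ x → 1 ≤ g x
  const : ∀ x, 0 ≤ x → x ≤ 2 → g x = g 2
  mono : MonotoneOn g (Set.Ici 0)
  sum_le : ∑' j : ℕ, ∑' k : ℕ,
    ENNReal.ofReal (Real.exp 1 / g (((j : ℝ) + 1) + ((k : ℝ) + 1))) ≤ 1

/-- `κ_t = √((log ℓ(log₂ t) + log(4/δ)) / t)`. -/
noncomputable def kappaOne (l : ℝ → ℝ) (δ : ℝ) (t : ℕ) : ℝ :=
  Real.sqrt ((Real.log (l (Real.logb 2 t)) + Real.log (4 / δ)) / t)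

/-- `κ_{ts} = κ_t + κ_s`. -/
noncomputable def kappaTwo (l : ℝ → ℝ) (δ : ℝ) (t s : ℕ) : ℝ :=
  kappaOne l δ t + kappaOne l δ s

section Empirical

variable {α : Type*}

/-- The indicator of `x i`, divided by the multiplicity of `x i` among the first `t` terms. -/
noncomputable def sharedIndicator (x : ℕ → α) (t i : ℕ) (e : α) : ℝ≥0∞ := by
  classical
  exact if x i = e then (((Finset.range t).filter fun k => x k = e).card : ℝ≥0∞)⁻¹ else 0

lemma sum_sharedIndicator_le (x : ℕ → α) (t : ℕ) (e : α) :
    ∑ i ∈ Finset.range t, sharedIndicator x t i e ≤ 1 := by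
  classical
  simp only [sharedIndicator]
  rw [← Finset.sum_filter, Finset.sum_const, nsmul_eq_mul]
  exact ENNReal.mul_inv_le_one _

lemma sum_sharedIndicator_eq (x : ℕ → α) {t k : ℕ} (hk : k < t) :
    ∑ i ∈ Finset.range t, sharedIndicator x t i (x k) = 1 := by
  classical
  simp only [sharedIndicator]
  rw [← Finset.sum_filter, Finset.sum_const, nsmul_eq_mul]
  refine ENNReal.mul_inv_cancel ?_ (by simp)
  simp only [ne_eq, Nat.cast_eq_zero, Finset.card_eq_zero]
  exact Finset.ne_empty_of_mem (a := k) (by simp [hk])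

lemma sum_sharedIndicator_apply (x : ℕ → α) {t i : ℕ} (hi : i < t) :
    ∑ k ∈ Finset.range t, sharedIndicator x t i (x k) = 1 := by
  rw [← sum_sharedIndicator_eq x hi]
  refine Finset.sum_congr rfl fun k _ => ?_
  simp only [sharedIndicator]
  by_cases h : x i = x k
  · rw [if_pos h, if_pos h.symm, h]
  · simp [h, Ne.symm h]

lemma sum_sum_swap {M : Type*} [AddCommMonoid M] (f : ℕ → M) (t : ℕ) :
    ∑ i ∈ Finset.range (t + 1), ∑ k ∈ Finset.range t, f (Equiv.swap i t k)
      = t • ∑ k ∈ Finset.range (t + 1), f k := by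
  rw [Finset.sum_comm]
  have : ∀ k ∈ Finset.range t, ∑ i ∈ Finset.range (t + 1), f (Equiv.swap i t k) = t • f k + f t := by
    intro k hk
    have hkt : k < t := Finset.mem_range.1 hk
    have hk1 : k ∈ Finset.range (t + 1) := by simp; omega
    rw [← Finset.sum_erase_add _ _ hk1, Equiv.swap_apply_left]
    congr 1
    have : ∀ i ∈ (Finset.range (t + 1)).erase k, f (Equiv.swap i t k) = f k := by
      intro i hi
      rw [Equiv.swap_apply_of_ne_of_ne (Finset.ne_of_mem_erase hi).symm hkt.ne]
    rw [Finset.sum_congr rfl this, Finset.sum_const, Finset.card_erase_of_mem hk1]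
    simp
  rw [Finset.sum_congr rfl this, Finset.sum_add_distrib, ← Finset.smul_sum, Finset.sum_const,
    Finset.card_range, ← smul_add, Finset.sum_range_succ]

variable [MeasurableSpace α]

/-- The matrices with nonnegative entries, rows summing to `1 / t` and columns summing to `1 / s`. -/
def transportPolytope (t s : ℕ) : Set (ℕ → ℕ → ℝ≥0∞) :=
  {w | (∀ i ∈ Finset.range t, ∑ j ∈ Finset.range s, w i j = (t : ℝ≥0∞)⁻¹) ∧
    ∀ j ∈ Finset.range s, ∑ i ∈ Finset.range t, w i j = (s : ℝ≥0∞)⁻¹}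

lemma lintegral_empMeasure [MeasurableSingletonClass α] (x : ℕ → α) (t : ℕ) (f : α → ℝ≥0∞) :
    ∫⁻ e, f e ∂(empMeasure x t) = (t : ℝ≥0∞)⁻¹ * ∑ i ∈ Finset.range t, f (x i) := by
  simp [empMeasure, lintegral_smul_measure, lintegral_finsetSum_measure]

lemma isProbabilityMeasure_empMeasure (x : ℕ → α) {t : ℕ} (ht : 1 ≤ t) :
    IsProbabilityMeasure (empMeasure x t) := by
  constructor
  simp only [empMeasure, Measure.smul_apply, Measure.coe_finsetSum, Finset.sum_apply,
    measure_univ, Finset.sum_const, Finset.card_range, smul_eq_mul, nsmul_eq_mul, mul_one]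
  exact ENNReal.inv_mul_cancel (by exact_mod_cast (by omega)) (by simp)

lemma measurable_sharedIndicator [MeasurableSingletonClass α] (x : ℕ → α) (t i : ℕ) :
    Measurable (sharedIndicator x t i) := by
  classical
  have : sharedIndicator x t i = Set.indicator {x i} fun _ =>
      (((Finset.range t).filter fun k => x k = x i).card : ℝ≥0∞)⁻¹ := by
    ext e
    by_cases h : x i = e
    · simp [sharedIndicator, h]
    · simp [sharedIndicator, h, Ne.symm h]
  rw [this]
  exact measurable_const.indicator (measurableSet_singleton _)

lemma ae_sum_sharedIndicator_empMeasure [MeasurableSingletonClass α] (x : ℕ → α) (t : ℕ) :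
    ∀ᵐ e ∂(empMeasure x t), ∑ i ∈ Finset.range t, sharedIndicator x t i e = 1 := by
  have hm : MeasurableSet {e | ¬ ∑ i ∈ Finset.range t, sharedIndicator x t i e = 1} :=
    (measurableSet_eq_fun (Finset.measurable_sum _ fun i _ => measurable_sharedIndicator x t i)
      measurable_const).compl
  rw [ae_iff, ← lintegral_indicator_one hm, lintegral_empMeasure]
  refine mul_eq_zero_of_right _ (Finset.sum_eq_zero fun k hk => ?_)
  simp [sum_sharedIndicator_eq x (Finset.mem_range.1 hk)]

lemma exists_transportPolytope_le [MeasurableSingletonClass α] (c : α → α → ℝ≥0)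
    (hc : Measurable (Function.uncurry c)) (x y : ℕ → α) (t s : ℕ)
    {π : Measure (α × α)} (hπ : π ∈ couplings (empMeasure x t) (empMeasure y s)) :
    ∃ w ∈ transportPolytope t s,
      ∑ i ∈ Finset.range t, ∑ j ∈ Finset.range s, w i j * c (x i) (y j)
        ≤ ∫⁻ z, (c z.1 z.2 : ℝ≥0∞) ∂π := by
  obtain ⟨h1, h2⟩ := hπ
  have mx : ∀ i, Measurable fun z : α × α => sharedIndicator x t i z.1 := fun i =>
    (measurable_sharedIndicator x t i).comp measurable_fst
  have my : ∀ i, Measurable fun z : α × α => sharedIndicator y s i z.2 := fun i =>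
    (measurable_sharedIndicator y s i).comp measurable_snd
  have mxy : ∀ i j, Measurable fun z : α × α =>
      sharedIndicator x t i z.1 * sharedIndicator y s j z.2 := fun i j => (mx i).mul (my j)
  have a1 : ∀ᵐ z ∂π, ∑ i ∈ Finset.range t, sharedIndicator x t i z.1 = 1 := by
    have := ae_sum_sharedIndicator_empMeasure x t
    rw [← h1] at this
    exact ae_of_ae_map measurable_fst.aemeasurable this
  have a2 : ∀ᵐ z ∂π, ∑ i ∈ Finset.range s, sharedIndicator y s i z.2 = 1 := by
    have := ae_sum_sharedIndicator_empMeasure y s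
    rw [← h2] at this
    exact ae_of_ae_map measurable_snd.aemeasurable this
  refine ⟨fun i j => ∫⁻ z, sharedIndicator x t i z.1 * sharedIndicator y s j z.2 ∂π,
    ⟨fun i hi => ?_, fun j hj => ?_⟩, ?_⟩
  · refine (lintegral_finsetSum (Finset.range s) fun j _ => mxy i j).symm.trans ?_
    calc _ = ∫⁻ z, sharedIndicator x t i z.1 ∂π := by
          refine lintegral_congr_ae ?_
          filter_upwards [a2] with z hz
          rw [← Finset.mul_sum, hz, mul_one]
      _ = ∫⁻ e, sharedIndicator x t i e ∂(π.map Prod.fst) := by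
          rw [lintegral_map (measurable_sharedIndicator x t i) measurable_fst]
      _ = _ := by
          rw [h1, lintegral_empMeasure, sum_sharedIndicator_apply x (Finset.mem_range.1 hi), mul_one]
  · refine (lintegral_finsetSum (Finset.range t) fun i _ => mxy i j).symm.trans ?_
    calc _ = ∫⁻ z, sharedIndicator y s j z.2 ∂π := by
          refine lintegral_congr_ae ?_
          filter_upwards [a1] with z hz
          rw [← Finset.sum_mul, hz, one_mul]
      _ = ∫⁻ e, sharedIndicator y s j e ∂(π.map Prod.snd) := by
          rw [lintegral_map (measurable_sharedIndicator y s j) measurable_snd]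
      _ = _ := by
          rw [h2, lintegral_empMeasure, sum_sharedIndicator_apply y (Finset.mem_range.1 hj), mul_one]
  · have : ∀ i j, (∫⁻ z, sharedIndicator x t i z.1 * sharedIndicator y s j z.2 ∂π) * c (x i) (y j)
        = ∫⁻ z, sharedIndicator x t i z.1 * sharedIndicator y s j z.2 * c z.1 z.2 ∂π := by
      intro i j
      rw [← lintegral_mul_const _ (mxy i j)]
      refine lintegral_congr fun z => ?_
      simp only [sharedIndicator]
      by_cases hi : x i = z.1 <;> by_cases hj : y j = z.2 <;> simp [hi, hj]
    have mc : Measurable fun z : α × α => (c z.1 z.2 : ℝ≥0∞) := measurable_coe_nnreal_ennreal.comp hc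
    have mxyc : ∀ i j, Measurable fun z : α × α =>
        sharedIndicator x t i z.1 * sharedIndicator y s j z.2 * c z.1 z.2 :=
      fun i j => (mxy i j).mul mc
    have hsum : ∑ i ∈ Finset.range t, ∑ j ∈ Finset.range s,
        (∫⁻ z, sharedIndicator x t i z.1 * sharedIndicator y s j z.2 ∂π) * c (x i) (y j)
        = ∫⁻ z, ∑ i ∈ Finset.range t, ∑ j ∈ Finset.range s,
          sharedIndicator x t i z.1 * sharedIndicator y s j z.2 * c z.1 z.2 ∂π := by
      rw [lintegral_finsetSum _ fun i _ => Finset.measurable_sum _ fun j _ => mxyc i j]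
      refine Finset.sum_congr rfl fun i _ => ?_
      rw [lintegral_finsetSum _ fun j _ => mxyc i j]
      exact Finset.sum_congr rfl fun j _ => this i j
    refine hsum.trans_le (lintegral_mono fun z => ?_)
    calc _ = (∑ i ∈ Finset.range t, sharedIndicator x t i z.1) *
          (∑ j ∈ Finset.range s, sharedIndicator y s j z.2) * c z.1 z.2 := by
          rw [Finset.sum_mul_sum, Finset.sum_mul]
          refine Finset.sum_congr rfl fun i _ => ?_
          rw [Finset.sum_mul]
      _ ≤ 1 * 1 * c z.1 z.2 := by
          gcongr <;> exact sum_sharedIndicator_le _ _ _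
      _ = _ := by simp

lemma exists_coupling_of_transportPolytope [MeasurableSingletonClass α] (c : α → α → ℝ≥0)
    (x y : ℕ → α) {t s : ℕ} {w : ℕ → ℕ → ℝ≥0∞} (hw : w ∈ transportPolytope t s) :
    ∃ π ∈ couplings (empMeasure x t) (empMeasure y s), ∫⁻ z, (c z.1 z.2 : ℝ≥0∞) ∂π
      = ∑ i ∈ Finset.range t, ∑ j ∈ Finset.range s, w i j * c (x i) (y j) := by
  refine ⟨∑ i ∈ Finset.range t, ∑ j ∈ Finset.range s, w i j • Measure.dirac (x i, y j),
    ⟨?_, ?_⟩, ?_⟩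
  · ext A hA
    rw [Measure.map_apply measurable_fst hA]
    have : ∀ i j, Measure.dirac (x i, y j) (Prod.fst ⁻¹' A) = Measure.dirac (x i) A := by
      intro i j
      rw [Measure.dirac_apply' _ (measurable_fst hA), Measure.dirac_apply' _ hA]
      rfl
    simp only [Measure.coe_finsetSum, Finset.sum_apply, Measure.smul_apply, smul_eq_mul, this,
      empMeasure, Finset.mul_sum]
    refine Finset.sum_congr rfl fun i hi => ?_
    rw [← Finset.sum_mul, hw.1 i hi]
  · ext A hA
    rw [Measure.map_apply measurable_snd hA]
    have : ∀ i j, Measure.dirac (x i, y j) (Prod.snd ⁻¹' A) = Measure.dirac (y j) A := by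
      intro i j
      rw [Measure.dirac_apply' _ (measurable_snd hA), Measure.dirac_apply' _ hA]
      rfl
    simp only [Measure.coe_finsetSum, Finset.sum_apply, Measure.smul_apply, smul_eq_mul, this,
      empMeasure, Finset.mul_sum]
    rw [Finset.sum_comm]
    refine Finset.sum_congr rfl fun j hj => ?_
    rw [← Finset.sum_mul, hw.2 j hj]
  · simp [lintegral_finsetSum_measure, lintegral_smul_measure]

/-- The optimal transport cost between empirical measures is the value of a finite linear program. -/
lemma otCost_empMeasure [MeasurableSingletonClass α] (c : α → α → ℝ≥0)
    (hc : Measurable (Function.uncurry c)) (x y : ℕ → α) (t s : ℕ) :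
    otCost c (empMeasure x t) (empMeasure y s) = ⨅ w ∈ transportPolytope t s,
      ∑ i ∈ Finset.range t, ∑ j ∈ Finset.range s, w i j * c (x i) (y j) := by
  apply le_antisymm
  · refine le_iInf₂ fun w hw => ?_
    obtain ⟨π, hπ, h⟩ := exists_coupling_of_transportPolytope c x y hw
    rw [← h]
    exact iInf₂_le π hπ
  · refine le_iInf₂ fun π hπ => ?_
    obtain ⟨w, hw, h⟩ := exists_transportPolytope_le c hc x y t s hπ
    exact (iInf₂_le w hw).trans h

lemma otCost_le {c : α → α → ℝ≥0} {Δ : ℝ≥0} (hΔ : ∀ x y, c x y ≤ Δ)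
    (P Q : Measure α) [IsProbabilityMeasure P] [IsProbabilityMeasure Q] : otCost c P Q ≤ Δ := by
  have hm : P.prod Q ∈ couplings P Q := by
    constructor <;> simp
  refine (iInf₂_le _ hm).trans ?_
  calc _ ≤ ∫⁻ _, (Δ : ℝ≥0∞) ∂(P.prod Q) := lintegral_mono fun z => ENNReal.coe_le_coe.2 (hΔ _ _)
    _ = Δ := by simp

lemma measurable_otCost_empMeasure [MeasurableSingletonClass α] {c : α → α → ℝ≥0}
    (hc : Measurable (Function.uncurry c)) {t : ℕ} (ht : 1 ≤ t) (s : ℕ) :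
    Measurable fun z : (ℕ → α) × (ℕ → α) => otCost c (empMeasure z.1 t) (empMeasure z.2 s) := by
  have hF : UpperSemicontinuous fun C : Fin t → Fin s → ℝ≥0 =>
      ⨅ w ∈ transportPolytope t s, ∑ i : Fin t, ∑ j : Fin s, w i j * (C i j : ℝ≥0∞) := by
    refine upperSemicontinuous_biInf fun w hw => Continuous.upperSemicontinuous ?_
    refine continuous_finsetSum _ fun i _ => continuous_finsetSum _ fun j _ => ?_
    have : w i j ≠ ∞ := by
      have := hw.1 i (Finset.mem_range.2 i.2)
      intro h
      have h2 := Finset.single_le_sum (f := fun j => w i j) (fun _ _ => zero_le)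
        (Finset.mem_range.2 j.2)
      simp [h, this] at h2
      omega
    refine (ENNReal.continuous_const_mul this).comp ?_
    fun_prop
  have hC : Measurable fun z : (ℕ → α) × (ℕ → α) => fun (i : Fin t) (j : Fin s) =>
      c (z.1 i) (z.2 j) := by
    refine measurable_pi_lambda _ fun i => measurable_pi_lambda _ fun j => ?_
    have : Measurable fun z : (ℕ → α) × (ℕ → α) => (z.1 i, z.2 j) :=
      ((measurable_pi_apply _).comp measurable_fst).prodMk
        ((measurable_pi_apply _).comp measurable_snd)
    exact hc.comp this
  have := hF.measurable.comp hC
  convert this using 2 with z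
  rw [otCost_empMeasure c hc]
  simp only [Function.comp, Finset.sum_range]

lemma otCost_empMeasure_le_add [MeasurableSingletonClass α] {c : α → α → ℝ≥0} {Δ : ℝ≥0}
    (hc : Measurable (Function.uncurry c)) (hΔ : ∀ x y, c x y ≤ Δ) {x x' y : ℕ → α} (t s k : ℕ)
    (h : ∀ i, i ≠ k → x i = x' i) :
    otCost c (empMeasure x t) (empMeasure y s)
      ≤ otCost c (empMeasure x' t) (empMeasure y s) + Δ * (t : ℝ≥0∞)⁻¹ := by
  rw [otCost_empMeasure c hc x', ENNReal.iInf_add]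
  refine le_iInf fun w => ?_
  rw [ENNReal.iInf_add]
  refine le_iInf fun hw => ?_
  rw [otCost_empMeasure c hc]
  refine (iInf₂_le w hw).trans ?_
  have : ∀ i ∈ Finset.range t, ∑ j ∈ Finset.range s, w i j * (c (x i) (y j) : ℝ≥0∞)
      ≤ ∑ j ∈ Finset.range s, w i j * (c (x' i) (y j) : ℝ≥0∞)
        + if i = k then Δ * (t : ℝ≥0∞)⁻¹ else 0 := by
    intro i hi
    by_cases hik : i = k
    · simp only [hik, if_true]
      refine le_add_of_nonneg_of_le zero_le ?_
      rw [← hw.1 k (hik ▸ hi), Finset.mul_sum]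
      refine Finset.sum_le_sum fun j _ => ?_
      rw [mul_comm]
      gcongr
      exact_mod_cast hΔ _ _
    · simp [hik, h i hik]
  refine (Finset.sum_le_sum this).trans ?_
  rw [Finset.sum_add_distrib]
  gcongr
  rw [Finset.sum_ite_eq']
  split_ifs <;> simp

lemma le_otCost_empMeasure [MeasurableSingletonClass α] {c : α → α → ℝ≥0}
    (hc : Measurable (Function.uncurry c)) {Δ : ℝ≥0} (hΔ : ∀ x y, c x y ≤ Δ)
    {x y : ℕ → α} {t s : ℕ} (ht : 1 ≤ t) (hs : 1 ≤ s)
    {f g : α → ℝ} (h : ∀ i j, f (x i) + g (y j) ≤ c (x i) (y j)) :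
    (∑ i ∈ Finset.range t, f (x i)) / t + (∑ j ∈ Finset.range s, g (y j)) / s
      ≤ (otCost c (empMeasure x t) (empMeasure y s)).toReal := by
  have := isProbabilityMeasure_empMeasure x ht
  have := isProbabilityMeasure_empMeasure y hs
  refine le_of_forall_pos_le_add fun ε hε => ?_
  have hfin : otCost c (empMeasure x t) (empMeasure y s) ≠ ∞ :=
    ne_top_of_le_ne_top ENNReal.coe_ne_top (otCost_le hΔ _ _)
  have hlt : otCost c (empMeasure x t) (empMeasure y s)
      < otCost c (empMeasure x t) (empMeasure y s) + ENNReal.ofReal ε :=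
    ENNReal.lt_add_right hfin (by simpa using hε)
  nth_rewrite 1 [otCost_empMeasure c hc] at hlt
  simp only [iInf_lt_iff] at hlt
  obtain ⟨w, hw, hlt⟩ := hlt
  have hwf : ∀ i ∈ Finset.range t, ∀ j ∈ Finset.range s, w i j ≠ ∞ := by
    intro i hi j hj
    have := hw.1 i hi
    intro h
    have h2 := Finset.single_le_sum (f := fun j => w i j) (fun _ _ => zero_le) hj
    simp [h, this] at h2
    omega
  have e1 : ∀ i ∈ Finset.range t, ∑ j ∈ Finset.range s, (w i j).toReal = (t : ℝ)⁻¹ := by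
    intro i hi
    rw [← ENNReal.toReal_sum fun j hj => hwf i hi j hj, hw.1 i hi]
    simp
  have e2 : ∀ j ∈ Finset.range s, ∑ i ∈ Finset.range t, (w i j).toReal = (s : ℝ)⁻¹ := by
    intro j hj
    rw [← ENNReal.toReal_sum fun i hi => hwf i hi j hj, hw.2 j hj]
    simp
  have key := ENNReal.toReal_mono (by simp [hfin]) hlt.le
  rw [ENNReal.toReal_add hfin (by simp), ENNReal.toReal_ofReal hε.le, ENNReal.toReal_sum] at key
  · refine le_trans ?_ key
    calc _ = ∑ i ∈ Finset.range t, ∑ j ∈ Finset.range s, (w i j).toReal * (f (x i) + g (y j)) := by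
          simp_rw [mul_add, Finset.sum_add_distrib]
          congr 1
          · rw [Finset.sum_div]
            refine Finset.sum_congr rfl fun i hi => ?_
            rw [← Finset.sum_mul, e1 i hi]; ring
          · rw [Finset.sum_comm, Finset.sum_div]
            refine Finset.sum_congr rfl fun i hi => ?_
            rw [← Finset.sum_mul, e2 i hi]; ring
      _ ≤ _ := by
          refine Finset.sum_le_sum fun i hi => ?_
          rw [ENNReal.toReal_sum]
          · refine Finset.sum_le_sum fun j hj => ?_
            rw [ENNReal.toReal_mul]
            exact mul_le_mul_of_nonneg_left (h i j) ENNReal.toReal_nonneg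
          · intro j hj
            exact ENNReal.mul_ne_top (hwf i hi j hj) (by simp)
  · intro i hi
    exact ENNReal.sum_ne_top.2 fun j hj => ENNReal.mul_ne_top (hwf i hi j hj) (by simp)

lemma otCost_swap {c : α → α → ℝ≥0} (hc : Measurable (Function.uncurry c)) (P Q : Measure α) :
    otCost c P Q = otCost (fun a b => c b a) Q P := by
  have mc : Measurable fun z : α × α => (c z.1 z.2 : ℝ≥0∞) := measurable_coe_nnreal_ennreal.comp hc
  have key : ∀ (c : α → α → ℝ≥0), Measurable (fun z : α × α => (c z.1 z.2 : ℝ≥0∞)) →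
      ∀ P Q : Measure α, otCost (fun a b => c b a) Q P ≤ otCost c P Q := by
    intro c mc P Q
    refine le_iInf₂ fun π hπ => ?_
    have : π.map Prod.swap ∈ couplings Q P := by
      constructor
      · rw [Measure.map_map measurable_fst measurable_swap]; exact hπ.2
      · rw [Measure.map_map measurable_snd measurable_swap]; exact hπ.1
    refine (iInf₂_le _ this).trans ?_
    rw [lintegral_map (f := fun z : α × α => (c z.2 z.1 : ℝ≥0∞)) (mc.comp measurable_swap)
      measurable_swap]
    rfl
  exact le_antisymm (key (fun a b => c b a) (mc.comp measurable_swap) Q P) (key c mc P Q)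

/-- Convexity of the optimal transport cost in its first argument. -/
lemma otCost_sum_le {c : α → α → ℝ≥0} {Δ : ℝ≥0} (hΔ : ∀ x y, c x y ≤ Δ)
    {ι : Type*} (I : Finset ι) (w : ι → ℝ≥0∞) (hw : ∑ i ∈ I, w i = 1)
    (P : ι → Measure α) [∀ i, IsProbabilityMeasure (P i)] (Q : Measure α) [IsProbabilityMeasure Q] :
    otCost c (∑ i ∈ I, w i • P i) Q ≤ ∑ i ∈ I, w i * otCost c (P i) Q := by
  refine ENNReal.le_of_forall_pos_le_add fun ε hε _ => ?_
  have : ∀ i, ∃ π ∈ couplings (P i) Q, ∫⁻ z, (c z.1 z.2 : ℝ≥0∞) ∂π ≤ otCost c (P i) Q + ε := by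
    intro i
    have hfin : otCost c (P i) Q ≠ ∞ :=
      ne_top_of_le_ne_top ENNReal.coe_ne_top (otCost_le hΔ _ _)
    have hlt : otCost c (P i) Q < otCost c (P i) Q + ε :=
      ENNReal.lt_add_right hfin (by simpa using hε.ne')
    nth_rewrite 1 [otCost] at hlt
    simp only [iInf_lt_iff] at hlt
    obtain ⟨π, hπ, h⟩ := hlt
    exact ⟨π, hπ, h.le⟩
  choose π hπ hle using this
  have hm : ∑ i ∈ I, w i • π i ∈ couplings (∑ i ∈ I, w i • P i) Q := by
    constructor
    · ext A hA
      rw [Measure.map_apply measurable_fst hA]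
      simp only [Measure.coe_finsetSum, Finset.sum_apply, Measure.smul_apply, smul_eq_mul]
      refine Finset.sum_congr rfl fun i _ => ?_
      rw [← (hπ i).1, Measure.map_apply measurable_fst hA]
    · ext A hA
      rw [Measure.map_apply measurable_snd hA]
      simp only [Measure.coe_finsetSum, Finset.sum_apply, Measure.smul_apply, smul_eq_mul]
      have : ∀ i, π i (Prod.snd ⁻¹' A) = Q A := by
        intro i
        rw [← (hπ i).2, Measure.map_apply measurable_snd hA]
      simp_rw [this]
      rw [← Finset.sum_mul, hw, one_mul]
  refine (iInf₂_le _ hm).trans ?_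
  rw [lintegral_finsetSum_measure]
  simp only [lintegral_smul_measure, smul_eq_mul]
  calc _ ≤ ∑ i ∈ I, w i * (otCost c (P i) Q + ε) := by
        gcongr with i _
        exact hle i
    _ = _ := by
        simp_rw [mul_add, Finset.sum_add_distrib, ← Finset.sum_mul, hw, one_mul]

lemma otCost_empMeasure_succ_le {c : α → α → ℝ≥0} {Δ : ℝ≥0} (hΔ : ∀ x y, c x y ≤ Δ)
    (x : ℕ → α) {t : ℕ} (ht : 1 ≤ t) (Q : Measure α) [IsProbabilityMeasure Q] :
    otCost c (empMeasure x (t + 1)) Q ≤ ∑ i ∈ Finset.range (t + 1),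
      ((t + 1 : ℕ) : ℝ≥0∞)⁻¹ * otCost c (empMeasure (x ∘ Equiv.swap i t) t) Q := by
  have := fun i => isProbabilityMeasure_empMeasure (x ∘ Equiv.swap i t) ht
  have h := otCost_sum_le hΔ (Finset.range (t + 1)) (fun _ => ((t + 1 : ℕ) : ℝ≥0∞)⁻¹)
    (by
      rw [Finset.sum_const, Finset.card_range, nsmul_eq_mul]
      exact ENNReal.mul_inv_cancel (by simp) (by simp))
    (fun i => empMeasure (x ∘ Equiv.swap i t) t) Q
  convert h using 2
  rw [← Finset.smul_sum]
  simp only [empMeasure, Function.comp, ← Finset.smul_sum]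
  rw [sum_sum_swap (fun k => Measure.dirac (x k))]
  congr 1
  rw [← Nat.cast_smul_eq_nsmul ℝ≥0∞, smul_smul, ENNReal.inv_mul_cancel (by simp; omega) (by simp), one_smul]

lemma empMeasure_comp_swap (x : ℕ → α) {t i j : ℕ} (hi : i < t) (hj : j < t) :
    empMeasure (x ∘ Equiv.swap i j) t = empMeasure x t := by
  simp only [empMeasure, Function.comp]
  congr 1
  refine Finset.sum_equiv (Equiv.swap i j) (fun k => ?_) (fun _ _ => rfl)
  by_cases h1 : k = i
  · simp [h1, hi, hj]
  by_cases h2 : k = j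
  · simp [h2, hi, hj]
  rw [Equiv.swap_apply_of_ne_of_ne h1 h2]

end Empirical

section Duality

lemma integrable_of_measurable_of_bound {β : Type*} [MeasurableSpace β] {μ : Measure β}
    [IsFiniteMeasure μ] {f : β → ℝ} (hf : Measurable f) {K : ℝ} (h : ∀ x, |f x| ≤ K) :
    Integrable f μ :=
  Integrable.of_bound hf.aestronglyMeasurable K (Filter.Eventually.of_forall h)

variable {α : Type*} [MeasurableSpace α]

lemma measurable_integral_snd {Q : Measure α} [IsProbabilityMeasure Q] {h : α × α → ℝ}
    (hm : Measurable h) : Measurable fun x => ∫ y, h (x, y) ∂Q :=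
  (StronglyMeasurable.integral_prod_right (f := fun x y => h (x, y)) hm.stronglyMeasurable).measurable

lemma measurable_integral_fst {P : Measure α} [IsProbabilityMeasure P] {h : α × α → ℝ}
    (hm : Measurable h) : Measurable fun y => ∫ x, h (x, y) ∂P :=
  (StronglyMeasurable.integral_prod_left (f := fun x y => h (x, y)) hm.stronglyMeasurable).measurable

lemma withDensity_mem_couplings {P Q : Measure α} [IsProbabilityMeasure P] [IsProbabilityMeasure Q]
    {h : α × α → ℝ} (hm : Measurable h) (h0 : ∀ z, 0 ≤ h z) {K : ℝ} (hK : ∀ z, h z ≤ K)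
    (h1 : ∀ᵐ x ∂P, ∫ y, h (x, y) ∂Q = 1) (h2 : ∀ᵐ y ∂Q, ∫ x, h (x, y) ∂P = 1) :
    (P.prod Q).withDensity (fun z => ENNReal.ofReal (h z)) ∈ couplings P Q := by
  have mo : Measurable fun z => ENNReal.ofReal (h z) := hm.ennreal_ofReal
  have i1 : ∀ x, Integrable (fun y => h (x, y)) Q := fun x =>
    integrable_of_measurable_of_bound (hm.comp measurable_prodMk_left)
      (K := K) fun y => by rw [abs_of_nonneg (h0 _)]; exact hK _
  have i2 : ∀ y, Integrable (fun x => h (x, y)) P := fun y =>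
    integrable_of_measurable_of_bound (hm.comp measurable_prodMk_right)
      (K := K) fun x => by rw [abs_of_nonneg (h0 _)]; exact hK _
  constructor
  · ext A hA
    rw [Measure.map_apply measurable_fst hA, withDensity_apply _ (measurable_fst hA),
      ← lintegral_indicator (measurable_fst hA), lintegral_prod _
        (mo.indicator (measurable_fst hA)).aemeasurable, ← lintegral_indicator_one hA]
    refine lintegral_congr_ae ?_
    filter_upwards [h1] with x hx
    by_cases hxA : x ∈ A
    · simp only [hxA, Set.indicator_of_mem, Pi.one_apply, Set.mem_preimage]
      rw [← ofReal_integral_eq_lintegral_ofReal (i1 x) (Filter.Eventually.of_forall fun y => h0 _),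
        hx, ENNReal.ofReal_one]
    · simp [hxA]
  · ext A hA
    rw [Measure.map_apply measurable_snd hA, withDensity_apply _ (measurable_snd hA),
      ← lintegral_indicator (measurable_snd hA), lintegral_prod_symm _
        (mo.indicator (measurable_snd hA)).aemeasurable, ← lintegral_indicator_one hA]
    refine lintegral_congr_ae ?_
    filter_upwards [h2] with x hx
    by_cases hxA : x ∈ A
    · simp only [hxA, Set.indicator_of_mem, Pi.one_apply, Set.mem_preimage]
      rw [← ofReal_integral_eq_lintegral_ofReal (i2 x) (Filter.Eventually.of_forall fun y => h0 _),
        hx, ENNReal.ofReal_one]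
    · simp [hxA]

lemma otCost_toReal_le_integral_density {c : α → α → ℝ≥0} (hc : Measurable (Function.uncurry c))
    {Δ : ℝ≥0} (hΔ : ∀ x y, c x y ≤ Δ)
    {P Q : Measure α} [IsProbabilityMeasure P] [IsProbabilityMeasure Q]
    {h : α × α → ℝ} (hm : Measurable h) (h0 : ∀ z, 0 ≤ h z) {K : ℝ} (hK : ∀ z, h z ≤ K)
    (h1 : ∀ᵐ x ∂P, ∫ y, h (x, y) ∂Q = 1) (h2 : ∀ᵐ y ∂Q, ∫ x, h (x, y) ∂P = 1) :
    (otCost c P Q).toReal ≤ ∫ z, c z.1 z.2 * h z ∂(P.prod Q) := by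
  have mc : Measurable fun z : α × α => (c z.1 z.2 : ℝ) := measurable_coe_nnreal_real.comp hc
  have hi : Integrable (fun z => c z.1 z.2 * h z) (P.prod Q) := by
    refine integrable_of_measurable_of_bound (mc.mul hm) (K := Δ * K) fun z => ?_
    rw [abs_of_nonneg (mul_nonneg (NNReal.coe_nonneg _) (h0 z))]
    exact mul_le_mul (by exact_mod_cast hΔ _ _) (hK z) (h0 z) Δ.2
  have hn : 0 ≤ ∫ z, c z.1 z.2 * h z ∂(P.prod Q) :=
    integral_nonneg fun z => mul_nonneg (NNReal.coe_nonneg _) (h0 z)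
  refine ENNReal.toReal_le_of_le_ofReal hn ?_
  refine (iInf₂_le _ (withDensity_mem_couplings hm h0 hK h1 h2)).trans (le_of_eq ?_)
  have mc' : Measurable fun z : α × α => (c z.1 z.2 : ℝ≥0∞) := measurable_coe_nnreal_ennreal.comp hc
  rw [lintegral_withDensity_eq_lintegral_mul _ hm.ennreal_ofReal mc', ofReal_integral_eq_lintegral_ofReal hi
      (Filter.Eventually.of_forall fun z => mul_nonneg (NNReal.coe_nonneg _) (h0 z))]
  refine lintegral_congr fun z => ?_
  rw [ENNReal.ofReal_mul (NNReal.coe_nonneg _), ENNReal.ofReal_coe_nnreal, Pi.mul_apply, mul_comm]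

/-- A density whose marginal densities are nearly one can be corrected to a coupling at small
cost. -/
lemma otCost_toReal_le_of_almost_coupling {c : α → α → ℝ≥0}
    (hc : Measurable (Function.uncurry c)) {Δ : ℝ≥0} (hΔ : ∀ x y, c x y ≤ Δ)
    {P Q : Measure α} [IsProbabilityMeasure P] [IsProbabilityMeasure Q]
    {h : α × α → ℝ} (hm : Measurable h) (h0 : ∀ z, 0 ≤ h z) {K : ℝ} (hK : ∀ z, h z ≤ K) {η : ℝ}
    (h1 : ∫ x, |∫ y, h (x, y) ∂Q - 1| ∂P ≤ η) (h2 : ∫ y, |∫ x, h (x, y) ∂P - 1| ∂Q ≤ η) :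
    (otCost c P Q).toReal ≤ ∫ z, c z.1 z.2 * h z ∂(P.prod Q) + 3 * η * Δ := by
  have mc : Measurable fun z : α × α => (c z.1 z.2 : ℝ) := measurable_coe_nnreal_real.comp hc
  set p : α → ℝ := fun x => ∫ y, h (x, y) ∂Q with hp
  set q : α → ℝ := fun y => ∫ x, h (x, y) ∂P with hq
  have mp : Measurable p := measurable_integral_snd hm
  have mq : Measurable q := measurable_integral_fst hm
  have iS : ∀ {f : α × α → ℝ}, Measurable f → (∀ z, 0 ≤ f z) → (∀ z, f z ≤ K) → ∀ x,
      Integrable (fun y => f (x, y)) Q := fun hf h0 hK x =>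
    integrable_of_measurable_of_bound (hf.comp measurable_prodMk_left)
      (K := K) fun y => by rw [abs_of_nonneg (h0 _)]; exact hK _
  have iF : ∀ {f : α × α → ℝ}, Measurable f → (∀ z, 0 ≤ f z) → (∀ z, f z ≤ K) → ∀ y,
      Integrable (fun x => f (x, y)) P := fun hf h0 hK y =>
    integrable_of_measurable_of_bound (hf.comp measurable_prodMk_right)
      (K := K) fun x => by rw [abs_of_nonneg (h0 _)]; exact hK _
  have iP : ∀ {f : α × α → ℝ}, Measurable f → (∀ z, 0 ≤ f z) → (∀ z, f z ≤ K) →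
      Integrable f (P.prod Q) := fun hf h0 hK =>
    integrable_of_measurable_of_bound hf
      (K := K) fun y => by rw [abs_of_nonneg (h0 _)]; exact hK _
  have p0 : ∀ x, 0 ≤ p x := fun x => integral_nonneg fun y => h0 _
  have q0 : ∀ x, 0 ≤ q x := fun x => integral_nonneg fun y => h0 _
  have pK : ∀ x, p x ≤ K := fun x => by
    have := integral_mono (iS hm h0 hK x) (integrable_const K) (fun y => hK _)
    simpa using this
  have qK : ∀ x, q x ≤ K := fun x => by
    have := integral_mono (iF hm h0 hK x) (integrable_const K) (fun y => hK _)
    simpa using this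
  -- shrinking factors
  set a : α → ℝ := fun x => (max 1 (p x))⁻¹ with ha
  set b : α → ℝ := fun y => (max 1 (q y))⁻¹ with hb
  have ma : Measurable a := (measurable_const.max mp).inv
  have mb : Measurable b := (measurable_const.max mq).inv
  have a0 : ∀ x, 0 ≤ a x := fun x => inv_nonneg.2 (le_max_of_le_left zero_le_one)
  have b0 : ∀ x, 0 ≤ b x := fun x => inv_nonneg.2 (le_max_of_le_left zero_le_one)
  have a1 : ∀ x, a x ≤ 1 := fun x => inv_le_one_of_one_le₀ (le_max_left _ _)
  have b1 : ∀ x, b x ≤ 1 := fun x => inv_le_one_of_one_le₀ (le_max_left _ _)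
  have pa : ∀ x, p x * a x ≤ 1 := fun x => by
    rw [ha, ← div_eq_mul_inv, div_le_one (by positivity)]
    exact le_max_right _ _
  have qb : ∀ x, q x * b x ≤ 1 := fun x => by
    rw [hb, ← div_eq_mul_inv, div_le_one (by positivity)]
    exact le_max_right _ _
  have pa' : ∀ x, p x * (1 - a x) ≤ |p x - 1| := fun x => by
    rcases le_total (p x) 1 with hx | hx
    · simp [ha, hx]
    · simp only [ha, max_eq_right hx]
      rw [mul_sub, mul_inv_cancel₀ (by linarith), mul_one]
      exact le_abs_self _
  have qb' : ∀ x, q x * (1 - b x) ≤ |q x - 1| := fun x => by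
    rcases le_total (q x) 1 with hx | hx
    · simp [hb, hx]
    · simp only [hb, max_eq_right hx]
      rw [mul_sub, mul_inv_cancel₀ (by linarith), mul_one]
      exact le_abs_self _
  set k : α × α → ℝ := fun z => h z * a z.1 * b z.2 with hk
  have mk : Measurable k := (hm.mul (ma.comp measurable_fst)).mul (mb.comp measurable_snd)
  have k0 : ∀ z, 0 ≤ k z := fun z => mul_nonneg (mul_nonneg (h0 z) (a0 _)) (b0 _)
  have kh : ∀ z, k z ≤ h z := fun z => by
    simp only [hk]
    rw [mul_assoc]
    exact mul_le_of_le_one_right (h0 z) (mul_le_one₀ (a1 _) (b0 _) (b1 _))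
  have kK : ∀ z, k z ≤ K := fun z => (kh z).trans (hK z)
  set p' : α → ℝ := fun x => ∫ y, k (x, y) ∂Q with hp'
  set q' : α → ℝ := fun y => ∫ x, k (x, y) ∂P with hq'
  have mp' : Measurable p' := measurable_integral_snd mk
  have mq' : Measurable q' := measurable_integral_fst mk
  have p'0 : ∀ x, 0 ≤ p' x := fun x => integral_nonneg fun y => k0 _
  have q'0 : ∀ x, 0 ≤ q' x := fun x => integral_nonneg fun y => k0 _
  have p'1 : ∀ x, p' x ≤ 1 := fun x => by
    refine le_trans ?_ (pa x)
    rw [hp, ← integral_mul_const]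
    refine integral_mono (iS mk k0 kK x) ((iS hm h0 hK x).mul_const _) fun y => ?_
    exact mul_le_of_le_one_right (mul_nonneg (h0 _) (a0 _)) (b1 _)
  have q'1 : ∀ x, q' x ≤ 1 := fun x => by
    refine le_trans ?_ (qb x)
    rw [hq, ← integral_mul_const]
    refine integral_mono (iF mk k0 kK x) ((iF hm h0 hK x).mul_const _) fun y => ?_
    exact mul_le_mul_of_nonneg_right (mul_le_of_le_one_right (h0 _) (a1 _)) (b0 _)
  have ip' : Integrable p' P := integrable_of_measurable_of_bound mp' (K := 1) fun x => by
    rw [abs_of_nonneg (p'0 x)]; exact p'1 x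
  have iq' : Integrable q' Q := integrable_of_measurable_of_bound mq' (K := 1) fun x => by
    rw [abs_of_nonneg (q'0 x)]; exact q'1 x
  set m : ℝ := ∫ z, k z ∂(P.prod Q) with hmm
  have mp'' : ∫ x, p' x ∂P = m := (integral_prod _ (iP mk k0 kK)).symm
  have mq'' : ∫ y, q' y ∂Q = m := (integral_prod_symm _ (iP mk k0 kK)).symm
  have m1 : m ≤ 1 := by
    rw [← mp'']
    have := integral_mono ip' (integrable_const 1) (fun y => p'1 _)
    simpa using this
  have iabs : ∀ {r : α → ℝ} {R : Measure α} [IsProbabilityMeasure R], Measurable r →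
      (∀ x, 0 ≤ r x) → (∀ x, r x ≤ K) → Integrable (fun x => |r x - 1|) R := fun hr r0 rK =>
    integrable_of_measurable_of_bound (K := K + 1) (hr.sub_const 1).abs fun x => by
      rw [abs_abs, abs_le]; constructor <;> linarith [r0 x, rK x, (r0 x).trans (rK x)]
  have ibd : ∀ {r s : α → ℝ} {R : Measure α} [IsProbabilityMeasure R], Measurable r →
      (∀ x, 0 ≤ r x) → (∀ x, r x ≤ K) → Measurable s → (∀ x, 0 ≤ s x) → (∀ x, s x ≤ 1) →
      Integrable (fun x => r x * (1 - s x)) R := fun hr r0 rK hs s0 s1 =>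
    integrable_of_measurable_of_bound (K := K) (hr.mul (measurable_const.sub hs)) fun x => by
      rw [abs_of_nonneg (mul_nonneg (r0 x) (by linarith [s1 x]))]
      nlinarith [r0 x, rK x, s0 x, s1 x]
  have mlow : 1 - 3 * η ≤ m := by
    have i1 : Integrable (fun z : α × α => h z * (1 - a z.1)) (P.prod Q) :=
      iP (hm.mul (measurable_const.sub (ma.comp measurable_fst)))
        (fun z => mul_nonneg (h0 z) (by simpa using a1 _))
        (fun z => (mul_le_of_le_one_right (h0 z) (by simpa using a0 _)).trans (hK z))
    have i2 : Integrable (fun z : α × α => h z * (1 - b z.2)) (P.prod Q) :=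
      iP (hm.mul (measurable_const.sub (mb.comp measurable_snd)))
        (fun z => mul_nonneg (h0 z) (by simpa using b1 _))
        (fun z => (mul_le_of_le_one_right (h0 z) (by simpa using b0 _)).trans (hK z))
    have e0 : ∫ z, h z ∂(P.prod Q) = ∫ x, p x ∂P := integral_prod _ (iP hm h0 hK)
    have e1 : ∫ z, h z * (1 - a z.1) ∂(P.prod Q) = ∫ x, p x * (1 - a x) ∂P := by
      rw [integral_prod _ i1]
      refine integral_congr_ae (Filter.Eventually.of_forall fun x => ?_)
      simp only [integral_mul_const, hp]
    have e2 : ∫ z, h z * (1 - b z.2) ∂(P.prod Q) = ∫ x, q x * (1 - b x) ∂Q := by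
      rw [integral_prod_symm _ i2]
      refine integral_congr_ae (Filter.Eventually.of_forall fun x => ?_)
      simp only [integral_mul_const, hq]
    have l0 : 1 - η ≤ ∫ x, p x ∂P := by
      have : ∫ x, (1 - |p x - 1|) ∂P ≤ ∫ x, p x ∂P := by
        refine integral_mono ((integrable_const _).sub (iabs mp p0 pK))
          (integrable_of_measurable_of_bound mp (K := K) fun x => by
            rw [abs_of_nonneg (p0 x)]; exact pK x) fun x => ?_
        have := neg_abs_le (p x - 1)
        simp only
        linarith
      rw [integral_sub (integrable_const _) (iabs mp p0 pK)] at this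
      simp at this
      linarith
    have l1 : ∫ x, p x * (1 - a x) ∂P ≤ η :=
      (integral_mono (ibd mp p0 pK ma a0 a1) (iabs mp p0 pK) pa').trans h1
    have l2 : ∫ x, q x * (1 - b x) ∂Q ≤ η :=
      (integral_mono (ibd mq q0 qK mb b0 b1) (iabs mq q0 qK) qb').trans h2
    have := integral_mono (((iP hm h0 hK).sub i1).sub i2) (iP mk k0 kK) (fun z => by
      have := mul_nonneg (h0 z) (mul_nonneg (sub_nonneg.2 (a1 z.1)) (sub_nonneg.2 (b1 z.2)))
      simp only [hk, Pi.sub_apply]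
      nlinarith [this])
    rw [integral_sub' ((iP hm h0 hK).sub i1) i2, integral_sub' (iP hm h0 hK) i1] at this
    linarith
  set D : ℝ := 1 - m with hD
  have D0 : 0 ≤ D := by linarith
  set f : α × α → ℝ := fun z => k z + (1 - p' z.1) * (1 - q' z.2) / D with hf
  have hr0 : ∀ z : α × α, 0 ≤ (1 - p' z.1) * (1 - q' z.2) / D := fun z =>
    div_nonneg (mul_nonneg (by linarith [p'1 z.1]) (by linarith [q'1 z.2])) D0
  have hr1 : ∀ z : α × α, (1 - p' z.1) * (1 - q' z.2) / D ≤ 1 / D := fun z => by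
    gcongr
    exact mul_le_one₀ (by linarith [p'0 z.1]) (by linarith [q'1 z.2]) (by linarith [q'0 z.2])
  have mr : Measurable fun z : α × α => (1 - p' z.1) * (1 - q' z.2) / D :=
    ((measurable_const.sub (mp'.comp measurable_fst)).mul
      (measurable_const.sub (mq'.comp measurable_snd))).div_const _
  have ir : Integrable (fun z : α × α => (1 - p' z.1) * (1 - q' z.2) / D) (P.prod Q) :=
    integrable_of_measurable_of_bound mr (K := 1 / D) fun z => by
      rw [abs_of_nonneg (hr0 z)]; exact hr1 z
  have ip1 : Integrable (fun x => 1 - p' x) P := (integrable_const _).sub ip'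
  have iq1 : Integrable (fun x => 1 - q' x) Q := (integrable_const _).sub iq'
  have Ip : ∫ x, (1 - p' x) ∂P = D := by
    rw [integral_sub (integrable_const _) ip', mp'']; simp [hD]
  have Iq : ∫ x, (1 - q' x) ∂Q = D := by
    rw [integral_sub (integrable_const _) iq', mq'']; simp [hD]
  have aep : D = 0 → ∀ᵐ x ∂P, p' x = 1 := fun h => by
    rw [h, integral_eq_zero_iff_of_nonneg (fun x => by simpa using p'1 x) ip1] at Ip
    filter_upwards [Ip] with x hx
    simp only [Pi.zero_apply] at hx
    linarith
  have aeq : D = 0 → ∀ᵐ x ∂Q, q' x = 1 := fun h => by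
    rw [h, integral_eq_zero_iff_of_nonneg (fun x => by simpa using q'1 x) iq1] at Iq
    filter_upwards [Iq] with x hx
    simp only [Pi.zero_apply] at hx
    linarith
  have main := otCost_toReal_le_integral_density hc hΔ (P := P) (Q := Q) (h := f) (mk.add mr)
    (fun z => add_nonneg (k0 z) (hr0 z)) (K := K + 1 / D) (fun z => add_le_add (kK z) (hr1 z))
    (by
      have : ∀ x, ∫ y, f (x, y) ∂Q = p' x + (1 - p' x) * D / D := fun x => by
        simp only [hf]
        rw [integral_add (iS mk k0 kK x)
          ((iq1.const_mul _).div_const _), integral_div,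
          integral_const_mul, Iq]
      simp only [this]
      by_cases hD0 : D = 0
      · filter_upwards [aep hD0] with x hx
        simp [hx]
      · refine Filter.Eventually.of_forall fun x => ?_
        field_simp
        ring)
    (by
      have : ∀ y, ∫ x, f (x, y) ∂P = q' y + D * (1 - q' y) / D := fun x => by
        simp only [hf]
        rw [integral_add (iF mk k0 kK x)
          ((ip1.mul_const _).div_const _), integral_div,
          integral_mul_const, Ip]
      simp only [this]
      by_cases hD0 : D = 0
      · filter_upwards [aeq hD0] with x hx
        simp [hx]
      · refine Filter.Eventually.of_forall fun x => ?_
        field_simp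
        ring)
  refine main.trans ?_
  have ich : Integrable (fun z => c z.1 z.2 * h z) (P.prod Q) := by
    refine integrable_of_measurable_of_bound (mc.mul hm) (K := Δ * K) fun z => ?_
    rw [abs_of_nonneg (mul_nonneg (NNReal.coe_nonneg _) (h0 z))]
    exact mul_le_mul (by exact_mod_cast hΔ _ _) (hK z) (h0 z) Δ.2
  have icf : Integrable (fun z => c z.1 z.2 * f z) (P.prod Q) := by
    refine integrable_of_measurable_of_bound (mc.mul (mk.add mr)) (K := Δ * (K + 1 / D)) fun z => ?_
    rw [abs_of_nonneg (mul_nonneg (NNReal.coe_nonneg _) (add_nonneg (k0 z) (hr0 z)))]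
    exact mul_le_mul (by exact_mod_cast hΔ _ _) (add_le_add (kK z) (hr1 z))
      (add_nonneg (k0 z) (hr0 z)) Δ.2
  calc ∫ z, c z.1 z.2 * f z ∂(P.prod Q)
      ≤ ∫ z, (c z.1 z.2 * h z + Δ * ((1 - p' z.1) * (1 - q' z.2) / D)) ∂(P.prod Q) := by
        refine integral_mono icf (ich.add (ir.const_mul _)) fun z => ?_
        simp only [hf, mul_add]
        have hcz : (c z.1 z.2 : ℝ) ≤ Δ := by exact_mod_cast hΔ _ _
        exact add_le_add (mul_le_mul_of_nonneg_left (kh z) (NNReal.coe_nonneg _))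
          (mul_le_mul_of_nonneg_right hcz (hr0 z))
    _ = ∫ z, c z.1 z.2 * h z ∂(P.prod Q) + Δ * (D * D / D) := by
        rw [integral_add ich (ir.const_mul _), integral_const_mul, integral_div,
          integral_prod_mul (fun x => 1 - p' x) (fun y => 1 - q' y), Ip, Iq]
    _ ≤ _ := by
        have : D * D / D ≤ 3 * η := by
          rw [mul_self_div_self]; linarith
        have := mul_le_mul_of_nonneg_left this Δ.2
        simp only [NNReal.val_eq_coe] at this
        linarith

end Duality

section Duality

lemma integral_abs_le_norm_Lp_two {β : Type*} [MeasurableSpace β] {μ : Measure β}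
    [IsProbabilityMeasure μ] (u : Lp ℝ 2 μ) : ∫ x, |u x| ∂μ ≤ ‖u‖ := by
  have h := integral_norm_eq_lintegral_enorm (Lp.aestronglyMeasurable u)
  simp only [Real.norm_eq_abs] at h
  rw [h, ← eLpNorm_one_eq_lintegral_enorm, Lp.norm_def]
  exact ENNReal.toReal_mono (Lp.eLpNorm_ne_top u)
    (eLpNorm_le_eLpNorm_of_exponent_le (by norm_num) (Lp.aestronglyMeasurable u))

variable {α : Type*} [MeasurableSpace α]

/-- Marginals and (upper bounds of) costs of bounded densities with respect to `P.prod Q`. -/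
def densityCone (c : α → α → ℝ≥0) (P Q : Measure α) : Set (Lp ℝ 2 P × Lp ℝ 2 Q × ℝ) :=
  {z | ∃ h : α × α → ℝ, Measurable h ∧ (∀ w, 0 ≤ h w) ∧ (∃ K, ∀ w, h w ≤ K) ∧
    (z.1 =ᵐ[P] fun x => ∫ y, h (x, y) ∂Q) ∧ (z.2.1 =ᵐ[Q] fun y => ∫ x, h (x, y) ∂P) ∧
    ∫ w, c w.1 w.2 * h w ∂(P.prod Q) ≤ z.2.2}

section

variable {c : α → α → ℝ≥0} (hc : Measurable (Function.uncurry c)) {Δ : ℝ≥0}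
  (hΔ : ∀ x y, c x y ≤ Δ) {P Q : Measure α} [IsProbabilityMeasure P] [IsProbabilityMeasure Q]

include hc hΔ

lemma integrable_cost_mul {h : α × α → ℝ} (hm : Measurable h) (h0 : ∀ w, 0 ≤ h w) {K : ℝ}
    (hK : ∀ w, h w ≤ K) : Integrable (fun w => c w.1 w.2 * h w) (P.prod Q) := by
  have mc : Measurable fun z : α × α => (c z.1 z.2 : ℝ) := measurable_coe_nnreal_real.comp hc
  refine integrable_of_measurable_of_bound (mc.mul hm) (K := Δ * K) fun z => ?_
  rw [abs_of_nonneg (mul_nonneg (NNReal.coe_nonneg _) (h0 z))]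
  exact mul_le_mul (by exact_mod_cast hΔ _ _) (hK z) (h0 z) Δ.2

lemma smul_add_mem_densityCone {z w : Lp ℝ 2 P × Lp ℝ 2 Q × ℝ} (hz : z ∈ densityCone c P Q)
    (hw : w ∈ densityCone c P Q) {a b : ℝ} (ha : 0 ≤ a) (hb : 0 ≤ b) :
    a • z + b • w ∈ densityCone c P Q := by
  obtain ⟨h, hm, h0, ⟨K, hK⟩, e1, e2, e3⟩ := hz
  obtain ⟨h', hm', h0', ⟨K', hK'⟩, e1', e2', e3'⟩ := hw
  have iQ : ∀ {f : α × α → ℝ} {K : ℝ}, Measurable f → (∀ z, 0 ≤ f z) → (∀ z, f z ≤ K) → ∀ x,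
      Integrable (fun y => f (x, y)) Q := fun {f K} hf h0 hK x =>
    integrable_of_measurable_of_bound (hf.comp measurable_prodMk_left)
      (K := K) fun y => by rw [abs_of_nonneg (h0 _)]; exact hK _
  have iP : ∀ {f : α × α → ℝ} {K : ℝ}, Measurable f → (∀ z, 0 ≤ f z) → (∀ z, f z ≤ K) → ∀ y,
      Integrable (fun x => f (x, y)) P := fun {f K} hf h0 hK y =>
    integrable_of_measurable_of_bound (hf.comp measurable_prodMk_right)
      (K := K) fun x => by rw [abs_of_nonneg (h0 _)]; exact hK _
  refine ⟨fun p => a * h p + b * h' p, (hm.const_mul a).add (hm'.const_mul b),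
    fun p => add_nonneg (mul_nonneg ha (h0 p)) (mul_nonneg hb (h0' p)),
    ⟨a * K + b * K', fun p => add_le_add (mul_le_mul_of_nonneg_left (hK p) ha)
      (mul_le_mul_of_nonneg_left (hK' p) hb)⟩, ?_, ?_, ?_⟩
  · simp only [Prod.fst_add, Prod.smul_fst]
    filter_upwards [Lp.coeFn_add (a • z.1) (b • w.1), Lp.coeFn_smul a z.1, Lp.coeFn_smul b w.1,
      e1, e1'] with x q1 q2 q3 q4 q5
    rw [q1, Pi.add_apply, q2, q3, Pi.smul_apply, Pi.smul_apply, q4, q5,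
      integral_add ((iQ hm h0 hK x).const_mul a) ((iQ hm' h0' hK' x).const_mul b),
      integral_const_mul, integral_const_mul]
    rfl
  · simp only [Prod.fst_add, Prod.smul_fst, Prod.snd_add, Prod.smul_snd]
    filter_upwards [Lp.coeFn_add (a • z.2.1) (b • w.2.1), Lp.coeFn_smul a z.2.1,
      Lp.coeFn_smul b w.2.1, e2, e2'] with x q1 q2 q3 q4 q5
    rw [q1, Pi.add_apply, q2, q3, Pi.smul_apply, Pi.smul_apply, q4, q5,
      integral_add ((iP hm h0 hK x).const_mul a) ((iP hm' h0' hK' x).const_mul b),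
      integral_const_mul, integral_const_mul]
    rfl
  · simp only [Prod.snd_add, Prod.smul_snd, smul_eq_mul]
    have e : (fun p : α × α => (c p.1 p.2 : ℝ) * (a * h p + b * h' p)) =
        fun p => a * (c p.1 p.2 * h p) + b * (c p.1 p.2 * h' p) := by
      ext p; ring
    rw [e, integral_add ((integrable_cost_mul hc hΔ hm h0 hK).const_mul a)
      ((integrable_cost_mul hc hΔ hm' h0' hK').const_mul b), integral_const_mul,
      integral_const_mul]
    gcongr

lemma otCost_toReal_le_of_mem_closure {v : ℝ}
    (hv : ((memLp_const (1 : ℝ)).toLp _, (memLp_const (1 : ℝ)).toLp _, v)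
      ∈ closure (densityCone c P Q)) :
    (otCost c P Q).toReal ≤ v := by
  refine le_of_forall_pos_le_add fun ε hε => ?_
  have hη : 0 < ε / (1 + 3 * Δ) := by positivity
  obtain ⟨z, ⟨h, hm, h0, ⟨K, hK⟩, e1, e2, e3⟩, hd⟩ := Metric.mem_closure_iff.1 hv _ hη
  set η := ε / (1 + 3 * Δ) with hηd
  simp only [Prod.dist_eq, max_lt_iff] at hd
  obtain ⟨d1, d2, d3⟩ := hd
  have b1 : ∫ x, |∫ y, h (x, y) ∂Q - 1| ∂P ≤ η := by
    refine le_trans (le_of_eq ?_) ((integral_abs_le_norm_Lp_two _).trans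
      ((dist_eq_norm z.1 _).symm.trans_le ((dist_comm _ _).trans_le d1.le)))
    refine integral_congr_ae ?_
    filter_upwards [Lp.coeFn_sub z.1 ((memLp_const (1 : ℝ)).toLp _), e1,
      (memLp_const (μ := P) (p := 2) (1 : ℝ)).coeFn_toLp] with x q1 q2 q3
    rw [q1, Pi.sub_apply, q2, q3]
  have b2 : ∫ y, |∫ x, h (x, y) ∂P - 1| ∂Q ≤ η := by
    refine le_trans (le_of_eq ?_) ((integral_abs_le_norm_Lp_two _).trans
      ((dist_eq_norm z.2.1 _).symm.trans_le ((dist_comm _ _).trans_le d2.le)))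
    refine integral_congr_ae ?_
    filter_upwards [Lp.coeFn_sub z.2.1 ((memLp_const (1 : ℝ)).toLp _), e2,
      (memLp_const (μ := Q) (p := 2) (1 : ℝ)).coeFn_toLp] with x q1 q2 q3
    rw [q1, Pi.sub_apply, q2, q3]
  have := otCost_toReal_le_of_almost_coupling hc hΔ hm h0 hK b1 b2
  rw [Real.dist_eq, abs_lt] at d3
  have h4 : η * (1 + 3 * Δ) = ε := by rw [hηd]; field_simp
  nlinarith

/-- Weak form of Kantorovich duality: the dual constraint holds almost everywhere for the product
measure. -/
lemma exists_integrable_potentials {v : ℝ} (hv : v < (otCost c P Q).toReal) :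
    ∃ f g : α → ℝ, Measurable f ∧ Measurable g ∧ Integrable f P ∧ Integrable g Q ∧
      (∀ᵐ z ∂(P.prod Q), f z.1 + g z.2 ≤ c z.1 z.2) ∧ v < ∫ x, f x ∂P + ∫ y, g y ∂Q := by
  have mc : Measurable fun z : α × α => (c z.1 z.2 : ℝ) := measurable_coe_nnreal_real.comp hc
  have hnot : ((memLp_const (1 : ℝ)).toLp _, (memLp_const (1 : ℝ)).toLp _, v)
      ∉ closure (densityCone c P Q) := fun h =>
    not_le_of_gt hv (otCost_toReal_le_of_mem_closure hc hΔ h)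
  have hconv : Convex ℝ (densityCone c P Q) := fun z hz w hw a b ha hb _ =>
    smul_add_mem_densityCone hc hΔ hz hw ha hb
  obtain ⟨φ, u, hφ, hu⟩ := geometric_hahn_banach_closed_point hconv.closure isClosed_closure hnot
  have hzero : (0 : Lp ℝ 2 P × Lp ℝ 2 Q × ℝ) ∈ densityCone c P Q := by
    refine ⟨fun _ => 0, measurable_const, fun _ => le_rfl, ⟨0, fun _ => le_rfl⟩, ?_, ?_, by simp⟩
    · simp only [integral_zero]; exact Lp.coeFn_zero ℝ 2 P
    · simp only [integral_zero]; exact Lp.coeFn_zero ℝ 2 Q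
  have hu0 : 0 < u := by simpa using hφ 0 (subset_closure hzero)
  have hle : ∀ z ∈ densityCone c P Q, φ z ≤ 0 := by
    intro z hz
    by_contra! hpos
    have hs : 0 ≤ u / φ z := by positivity
    have := smul_add_mem_densityCone hc hΔ hz hzero hs le_rfl
    have := hφ _ (subset_closure this)
    rw [map_add, map_smul, map_smul, smul_eq_mul, div_mul_cancel₀ _ hpos.ne'] at this
    simp at this
  set F : Lp ℝ 2 P := (InnerProductSpace.toDual ℝ _).symm
    (φ.comp (ContinuousLinearMap.inl ℝ (Lp ℝ 2 P) (Lp ℝ 2 Q × ℝ))) with hF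
  set G : Lp ℝ 2 Q := (InnerProductSpace.toDual ℝ _).symm
    (φ.comp ((ContinuousLinearMap.inr ℝ (Lp ℝ 2 P) (Lp ℝ 2 Q × ℝ)).comp
      (ContinuousLinearMap.inl ℝ (Lp ℝ 2 Q) ℝ))) with hG
  set a : ℝ := φ (0, 0, 1) with ha
  have hφeq : ∀ (p : Lp ℝ 2 P) (q : Lp ℝ 2 Q) (r : ℝ),
      φ (p, q, r) = ∫ x, F x * p x ∂P + ∫ y, G y * q y ∂Q + r * a := by
    intro p q r
    have e1 : φ (p, 0, 0) = ∫ x, F x * p x ∂P := by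
      have : inner ℝ F p = φ (p, 0, 0) := by
        rw [hF, InnerProductSpace.toDual_symm_apply]; rfl
      rw [← this, L2.inner_def]
      refine integral_congr_ae (Filter.Eventually.of_forall fun x => ?_)
      simp [mul_comm]
    have e2 : φ (0, q, 0) = ∫ x, G x * q x ∂Q := by
      have : inner ℝ G q = φ (0, q, 0) := by
        rw [hG, InnerProductSpace.toDual_symm_apply]; rfl
      rw [← this, L2.inner_def]
      refine integral_congr_ae (Filter.Eventually.of_forall fun x => ?_)
      simp [mul_comm]
    have e3 : φ (0, 0, r) = r * a := by
      rw [ha, ← smul_eq_mul, ← map_smul]; simp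
    rw [← e1, ← e2, ← e3, ← map_add, ← map_add]
    simp
  have mF : Measurable F := (Lp.stronglyMeasurable F).measurable
  have mG : Measurable G := (Lp.stronglyMeasurable G).measurable
  have iF : Integrable F P := (Lp.memLp F).integrable (by norm_num)
  have iG : Integrable G Q := (Lp.memLp G).integrable (by norm_num)
  have a0 : a ≤ 0 := by
    refine hle _ ⟨fun _ => 0, measurable_const, fun _ => le_rfl, ⟨0, fun _ => le_rfl⟩, ?_, ?_,
      by simp⟩
    · simp only [integral_zero]; exact Lp.coeFn_zero ℝ 2 P
    · simp only [integral_zero]; exact Lp.coeFn_zero ℝ 2 Q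
  have hpt : 0 < ∫ x, F x ∂P + ∫ y, G y ∂Q + v * a := by
    have := hu0.trans hu
    rw [hφeq] at this
    have e1 : ∫ x, F x * (memLp_const (μ := P) (p := 2) (1 : ℝ)).toLp _ x ∂P = ∫ x, F x ∂P := by
      refine integral_congr_ae ?_
      filter_upwards [(memLp_const (μ := P) (p := 2) (1 : ℝ)).coeFn_toLp] with x hx
      rw [hx, mul_one]
    have e2 : ∫ x, G x * (memLp_const (μ := Q) (p := 2) (1 : ℝ)).toLp _ x ∂Q = ∫ x, G x ∂Q := by
      refine integral_congr_ae ?_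
      filter_upwards [(memLp_const (μ := Q) (p := 2) (1 : ℝ)).coeFn_toLp] with x hx
      rw [hx, mul_one]
    rwa [e1, e2] at this
  set S : α × α → ℝ := fun z => F z.1 + G z.2 + a * c z.1 z.2 with hS
  have mS : Measurable S :=
    ((mF.comp measurable_fst).add (mG.comp measurable_snd)).add (mc.const_mul a)
  have ic : Integrable (fun z : α × α => (c z.1 z.2 : ℝ)) (P.prod Q) := by
    simpa using integrable_cost_mul hc hΔ (P := P) (Q := Q) (h := fun _ => 1) measurable_const
      (fun _ => zero_le_one) (K := 1) (fun _ => le_rfl)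
  have hae : ∀ᵐ z ∂(P.prod Q), S z ≤ 0 := by
    set A : Set (α × α) := {z | 0 < S z} with hA
    have mA : MeasurableSet A := measurableSet_lt measurable_const mS
    set h : α × α → ℝ := A.indicator fun _ => 1 with hh
    have hm : Measurable h := measurable_const.indicator mA
    have h0 : ∀ z, 0 ≤ h z := fun z => Set.indicator_nonneg (fun _ _ => zero_le_one) z
    have h1 : ∀ z, h z ≤ 1 := fun z => Set.indicator_le_self' (fun _ _ => zero_le_one) z
    have habs : ∀ z, |h z| ≤ 1 := fun z => by rw [abs_of_nonneg (h0 z)]; exact h1 z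
    have mp : Measurable fun x => ∫ y, h (x, y) ∂Q := measurable_integral_snd hm
    have mq : Measurable fun y => ∫ x, h (x, y) ∂P := measurable_integral_fst hm
    have bp : ∀ x, ‖∫ y, h (x, y) ∂Q‖ ≤ 1 := fun x => by
      simpa using norm_integral_le_of_norm_le_const (μ := Q) (f := fun y => h (x, y)) (C := 1)
        (Filter.Eventually.of_forall fun y => habs _)
    have bq : ∀ y, ‖∫ x, h (x, y) ∂P‖ ≤ 1 := fun y => by
      simpa using norm_integral_le_of_norm_le_const (μ := P) (f := fun x => h (x, y)) (C := 1)
        (Filter.Eventually.of_forall fun y => habs _)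
    have Lp1 : MemLp (fun x => ∫ y, h (x, y) ∂Q) 2 P :=
      MemLp.of_bound mp.aestronglyMeasurable 1 (Filter.Eventually.of_forall bp)
    have Lq1 : MemLp (fun y => ∫ x, h (x, y) ∂P) 2 Q :=
      MemLp.of_bound mq.aestronglyMeasurable 1 (Filter.Eventually.of_forall bq)
    have hmem : (Lp1.toLp _, Lq1.toLp _, ∫ w, c w.1 w.2 * h w ∂(P.prod Q)) ∈ densityCone c P Q :=
      ⟨h, hm, h0, ⟨1, h1⟩, Lp1.coeFn_toLp, Lq1.coeFn_toLp, le_rfl⟩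
    have key := hle _ hmem
    rw [hφeq] at key
    have i1 : Integrable (fun z : α × α => F z.1 * h z) (P.prod Q) :=
      iF.comp_fst Q |>.mul_bdd (c := 1) hm.aestronglyMeasurable (Filter.Eventually.of_forall habs)
    have i2 : Integrable (fun z : α × α => G z.2 * h z) (P.prod Q) :=
      iG.comp_snd P |>.mul_bdd (c := 1) hm.aestronglyMeasurable (Filter.Eventually.of_forall habs)
    have i3 := integrable_cost_mul hc hΔ (P := P) (Q := Q) hm h0 h1
    have i12 : Integrable (fun z : α × α => F z.1 * h z + G z.2 * h z) (P.prod Q) := i1.add i2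
    have q1 : ∫ x, F x * Lp1.toLp _ x ∂P = ∫ z, F z.1 * h z ∂(P.prod Q) := by
      rw [integral_prod _ i1]
      refine integral_congr_ae ?_
      filter_upwards [Lp1.coeFn_toLp] with x hx
      rw [hx, integral_const_mul]
    have q2 : ∫ y, G y * Lq1.toLp _ y ∂Q = ∫ z, G z.2 * h z ∂(P.prod Q) := by
      rw [integral_prod_symm _ i2]
      refine integral_congr_ae ?_
      filter_upwards [Lq1.coeFn_toLp] with x hx
      rw [hx, integral_const_mul]
    rw [q1, q2, ← integral_add i1 i2, ← integral_mul_const, ← integral_add i12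
      (i3.mul_const a)] at key
    have hn : ∀ z, 0 ≤ F z.1 * h z + G z.2 * h z + c z.1 z.2 * h z * a := by
      intro z
      by_cases hz : z ∈ A
      · have : 0 < S z := hz
        simp only [hh, Set.indicator_of_mem hz]
        simp only [hS] at this
        nlinarith
      · simp [hh, hz]
    have := (integral_eq_zero_iff_of_nonneg hn (i12.add (i3.mul_const a))).1
      (le_antisymm key (integral_nonneg hn))
    filter_upwards [this] with z hz
    by_contra! hpos
    have hzA : z ∈ A := hpos
    simp only [hh, Set.indicator_of_mem hzA, Pi.zero_apply] at hz
    simp only [hS] at hpos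
    nlinarith
  have a1 : a < 0 := by
    refine lt_of_le_of_ne a0 fun h => ?_
    rw [h, mul_zero, add_zero] at hpt
    have e1 : ∫ z, F z.1 ∂(P.prod Q) = ∫ x, F x ∂P := by
      simpa using integral_fun_fst (μ := P) (ν := Q) (f := F)
    have e2 : ∫ z, G z.2 ∂(P.prod Q) = ∫ x, G x ∂Q := by
      simpa using integral_fun_snd (μ := P) (ν := Q) (f := G)
    rw [← e1, ← e2, ← integral_add (iF.comp_fst Q) (iG.comp_snd P)] at hpt
    refine not_le_of_gt hpt (integral_nonpos_of_ae ?_)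
    filter_upwards [hae] with z hz
    simpa [hS, h] using hz
  refine ⟨fun x => F x / (-a), fun y => G y / (-a), mF.div_const _, mG.div_const _,
    iF.div_const _, iG.div_const _, ?_, ?_⟩
  · filter_upwards [hae] with z hz
    rw [← add_div, div_le_iff₀ (by linarith)]
    simp only [hS] at hz
    linarith
  · rw [integral_div, integral_div, ← add_div, lt_div_iff₀ (by linarith)]
    linarith

/-- The dual potentials can be chosen with oscillation at most `Δ`. -/
lemma exists_bounded_potentials {v : ℝ} (hv : v < (otCost c P Q).toReal) :
    ∃ (f g : α → ℝ) (M : ℝ), Measurable f ∧ Measurable g ∧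
      (∀ x, f x ∈ Set.Icc (M - Δ) M) ∧ (∀ y, g y ∈ Set.Icc (-M) (Δ - M)) ∧
      (∀ᵐ z ∂(P.prod Q), f z.1 + g z.2 ≤ c z.1 z.2) ∧ v < ∫ x, f x ∂P + ∫ y, g y ∂Q := by
  obtain ⟨f, g, mf, mg, hfi, hgi, hfg, hvlt⟩ := exists_integrable_potentials hc hΔ hv
  have hle : ∀ᵐ y ∂Q, ∀ᵐ x ∂P, f x + g y ≤ Δ := by
    have h1 : ∀ᵐ z ∂(P.prod Q), f z.1 + g z.2 ≤ Δ := by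
      filter_upwards [hfg] with z hz
      exact hz.trans (by exact_mod_cast hΔ _ _)
    have h2 : ∀ᵐ z ∂(Q.prod P), f z.2 + g z.1 ≤ Δ := by
      rw [← Measure.prod_swap] at h1
      exact ae_of_ae_map measurable_swap.aemeasurable h1
    exact Measure.ae_ae_of_ae_prod h2
  obtain ⟨y₀, hy₀⟩ := hle.exists
  have hbdd : Filter.IsBoundedUnder (· ≤ ·) (ae P) f :=
    ⟨Δ - g y₀, by simp only [Filter.eventually_map]; filter_upwards [hy₀] with x hx; linarith⟩
  set M := essSup f P with hM
  have hcob : Filter.IsCoboundedUnder (· ≤ ·) (ae P) f := by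
    have : ∃ b : ℝ, ∃ᶠ x in ae P, b ≤ f x := by
      by_contra! hcon
      have : ∀ n : ℕ, ∀ᵐ x ∂P, f x < -n := fun n => by
        simpa [Filter.not_frequently] using hcon (-n)
      obtain ⟨x, hx⟩ := (ae_all_iff.2 this).exists
      obtain ⟨n, hn⟩ := exists_nat_gt (-f x)
      linarith [hx n]
    obtain ⟨b, hb⟩ := this
    exact Filter.IsCobounded.of_frequently_ge hb
  have fM : ∀ᵐ x ∂P, f x ≤ M := ae_le_essSup hbdd
  have gM : ∀ᵐ y ∂Q, g y ≤ Δ - M := by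
    filter_upwards [hle] with y hy
    have : M ≤ Δ - g y := by
      refine essSup_le_of_ae_le _ ?_ hcob
      filter_upwards [hy] with x hx
      linarith
    linarith
  have ef : ∀ᵐ x ∂P, max (M - Δ) (min M (f x)) = max (M - Δ) (f x) := by
    filter_upwards [fM] with x hx
    rw [min_eq_right hx]
  have eg : ∀ᵐ x ∂Q, max (-M) (min (Δ - M) (g x)) = max (-M) (g x) := by
    filter_upwards [gM] with x hx
    rw [min_eq_right hx]
  have D0 : (0 : ℝ) ≤ Δ := Δ.2
  have mf' : Measurable fun x => max (M - Δ) (min M (f x)) :=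
    measurable_const.max (measurable_const.min mf)
  have mg' : Measurable fun x => max (-M) (min (Δ - M) (g x)) :=
    measurable_const.max (measurable_const.min mg)
  have rf : ∀ x, max (M - Δ) (min M (f x)) ∈ Set.Icc (M - Δ) M := fun x =>
    ⟨le_max_left _ _, max_le (by linarith) (min_le_left _ _)⟩
  have rg : ∀ x, max (-M) (min (Δ - M) (g x)) ∈ Set.Icc (-M) (Δ - M) := fun x =>
    ⟨le_max_left _ _, max_le (by linarith) (min_le_left _ _)⟩
  refine ⟨_, _, M, mf', mg', rf, rg, ?_, ?_⟩
  · have a1 : ∀ᵐ z ∂(P.prod Q), max (M - Δ) (min M (f z.1)) = max (M - Δ) (f z.1) ∧ f z.1 ≤ M :=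
      Measure.quasiMeasurePreserving_fst.ae (ef.and fM)
    have a2 : ∀ᵐ z ∂(P.prod Q), max (-M) (min (Δ - M) (g z.2)) = max (-M) (g z.2) ∧ g z.2 ≤ Δ - M :=
      Measure.quasiMeasurePreserving_snd.ae (eg.and gM)
    filter_upwards [hfg, a1, a2] with z h1 ⟨h2, h2'⟩ ⟨h3, h3'⟩
    rw [h2, h3]
    have c0 : (0 : ℝ) ≤ c z.1 z.2 := NNReal.coe_nonneg _
    rcases max_cases (M - Δ) (f z.1) with ⟨q1, _⟩ | ⟨q1, _⟩ <;>
      rcases max_cases (-M) (g z.2) with ⟨q2, _⟩ | ⟨q2, _⟩ <;> rw [q1, q2] <;> linarith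
  · refine hvlt.trans_le (add_le_add ?_ ?_)
    · refine integral_mono_ae hfi (integrable_of_measurable_of_bound mf' (K := |M - Δ| + |M|)
        fun x => abs_le.2 ⟨?_, ?_⟩) ?_
      · linarith [(rf x).1, neg_abs_le (M - Δ), abs_nonneg M]
      · linarith [(rf x).2, le_abs_self M, abs_nonneg (M - Δ)]
      · filter_upwards [ef] with x hx
        rw [hx]; exact le_max_right _ _
    · refine integral_mono_ae hgi (integrable_of_measurable_of_bound mg' (K := |-M| + |Δ - M|)
        fun x => abs_le.2 ⟨?_, ?_⟩) ?_
      · linarith [(rg x).1, neg_abs_le (-M), abs_nonneg (Δ - M)]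
      · linarith [(rg x).2, le_abs_self (Δ - M), abs_nonneg (-M)]
      · filter_upwards [eg] with x hx
        rw [hx]; exact le_max_right _ _

end

end Duality

section Exchangeable

/-- Pathwise version of Doob's weak type maximal inequality. -/
lemma sum_indicator_mul_sub_le (V : ℕ → ℝ) (r : ℝ) (n : ℕ) :
    ∑ k ∈ Finset.range n, (if r ≤ partialSups V k then 1 else 0) * (V (k + 1) - V k)
      ≤ (if r ≤ partialSups V n then 1 else 0) * (V n - r) := by
  induction n with
  | zero =>
    simp only [Finset.range_zero, Finset.sum_empty, partialSups_zero]
    split_ifs with h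
    · linarith
    · simp
  | succ n ih =>
    rw [Finset.sum_range_succ]
    refine (add_le_add_left ih _).trans ?_
    rw [partialSups_add_one]
    by_cases h : r ≤ partialSups V n
    · have h' : r ≤ partialSups V n ⊔ V (n + 1) := le_sup_of_le_left h
      simp only [if_pos h, if_pos h']
      linarith
    · simp only [if_neg h]
      split_ifs with h'
      · rcases le_sup_iff.1 h' with h1 | h1
        · exact absurd h1 h
        · linarith
      · simp

/-- Pathwise version of Doob's `L²` maximal inequality. -/
lemma sq_partialSups_add_le (V : ℕ → ℝ) (n : ℕ) :
    partialSups V n ^ 2 + 4 * ∑ k ∈ Finset.range n, partialSups V k * (V (k + 1) - V k)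
      ≤ 4 * V n ^ 2 := by
  have key : ∑ k ∈ Finset.range n, partialSups V k * (V (k + 1) - V k)
      ≤ partialSups V n * V n - partialSups V n ^ 2 / 2 := by
    induction n with
    | zero => simp; nlinarith [sq_nonneg (V 0)]
    | succ n ih =>
      rw [Finset.sum_range_succ, partialSups_add_one]
      rcases le_total (V (n + 1)) (partialSups V n) with h | h
      · rw [sup_eq_left.2 h]; linarith
      · rw [sup_eq_right.2 h]; nlinarith [sq_nonneg (V (n + 1) - partialSups V n)]
  nlinarith [sq_nonneg (partialSups V n - 2 * V n)]

lemma abs_partialSups_le {V : ℕ → ℝ} {n : ℕ} {K : ℝ} (h : ∀ k ≤ n, |V k| ≤ K) :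
    |partialSups V n| ≤ K :=
  abs_le.2 ⟨(abs_le.1 (h 0 n.zero_le)).1.trans (le_partialSups_of_le V n.zero_le),
    partialSups_le_iff.2 fun k hk => (abs_le.1 (h k hk)).2⟩

variable {α : Type*} [MeasurableSpace α]

/-- A sequence of bounded functionals of infinite sequences behaving like convex functionals of the
empirical measures: `Φ t` is symmetric in the first `t` coordinates, and `Φ (t + 1)` is at most
the average of the `t + 1` leave-one-out versions of `Φ t`. -/
structure IsEmpiricalConvex (Φ : ℕ → (ℕ → α) → ℝ) : Prop where
  measurable : ∀ t, 1 ≤ t → Measurable (Φ t)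
  bounded : ∃ K, ∀ t, 1 ≤ t → ∀ x, |Φ t x| ≤ K
  symm : ∀ t i j x, i < t → j < t → Φ t (x ∘ Equiv.swap i j) = Φ t x
  succ_le : ∀ t, 1 ≤ t → ∀ x,
    Φ (t + 1) x ≤ ∑ i ∈ Finset.range (t + 1), ((t + 1 : ℕ) : ℝ)⁻¹ * Φ t (x ∘ Equiv.swap i t)

/-- Invariance of the law of a sequence under transpositions of the coordinates. -/
def IsExchangeable (ν : Measure (ℕ → α)) : Prop :=
  ∀ i j, MeasurePreserving (fun x : ℕ → α => x ∘ Equiv.swap i j) ν ν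

lemma isExchangeable_infinitePi (P : Measure α) [IsProbabilityMeasure P] :
    IsExchangeable (Measure.infinitePi fun _ : ℕ => P) := fun i j =>
  ⟨measurable_pi_lambda _ fun _ => measurable_pi_apply _,
    Measure.map_infinitePi_infinitePi_of_inj (P := fun _ => P) (Equiv.swap i j).injective⟩

namespace IsEmpiricalConvex

lemma integrable {Φ : ℕ → (ℕ → α) → ℝ} (h : IsEmpiricalConvex Φ) {ν : Measure (ℕ → α)}
    [IsProbabilityMeasure ν] {t : ℕ} (ht : 1 ≤ t) : Integrable (Φ t) ν := by
  obtain ⟨K, hK⟩ := h.bounded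
  exact integrable_of_measurable_of_bound (h.measurable t ht) (hK t ht)

lemma exp_mul {Φ : ℕ → (ℕ → α) → ℝ} (h : IsEmpiricalConvex Φ) {r : ℝ} (hr : 0 ≤ r) :
    IsEmpiricalConvex fun t x => Real.exp (r * Φ t x) where
  measurable t ht := ((h.measurable t ht).const_mul r).exp
  bounded := by
    obtain ⟨K, hK⟩ := h.bounded
    refine ⟨Real.exp (r * K), fun t ht x => ?_⟩
    rw [abs_of_pos (Real.exp_pos _)]
    exact Real.exp_le_exp.2 (mul_le_mul_of_nonneg_left ((le_abs_self _).trans (hK t ht x)) hr)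
  symm t i j x hi hj := by rw [h.symm t i j x hi hj]
  succ_le t ht x := by
    refine (Real.exp_le_exp.2 (mul_le_mul_of_nonneg_left (h.succ_le t ht x) hr)).trans ?_
    have := convexOn_exp.map_sum_le (t := Finset.range (t + 1))
      (w := fun _ => ((t + 1 : ℕ) : ℝ)⁻¹) (p := fun i => r * Φ t (x ∘ Equiv.swap i t))
      (fun _ _ => by positivity)
      (by rw [Finset.sum_const, Finset.card_range, nsmul_eq_mul]; field_simp)
      (fun _ _ => Set.mem_univ _)
    simp only [smul_eq_mul] at this
    refine le_trans (le_of_eq ?_) this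
    rw [Finset.mul_sum]
    congr 1
    exact Finset.sum_congr rfl fun i _ => by ring

lemma partialSups_family {Φ : ℕ → ℕ → (ℕ → α) → ℝ} (n : ℕ) (h : ∀ k ≤ n, IsEmpiricalConvex (Φ k)) :
    IsEmpiricalConvex fun t x => partialSups (fun k => Φ k t x) n where
  measurable t ht := by
    induction n with
    | zero => simpa using (h 0 le_rfl).measurable t ht
    | succ n ih =>
      simp only [partialSups_add_one]
      exact (ih fun k hk => h k (hk.trans n.le_succ)).sup ((h (n + 1) le_rfl).measurable t ht)
  bounded := by
    have : ∀ k, ∃ K, k ≤ n → ∀ t, 1 ≤ t → ∀ x, |Φ k t x| ≤ K := fun k => by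
      by_cases hk : k ≤ n
      · obtain ⟨K, hK⟩ := (h k hk).bounded
        exact ⟨K, fun _ => hK⟩
      · exact ⟨0, fun h => absurd h hk⟩
    choose K hK using this
    refine ⟨∑ k ∈ Finset.range (n + 1), |K k|, fun t ht x => ?_⟩
    have hle : ∀ k ≤ n, |Φ k t x| ≤ ∑ k ∈ Finset.range (n + 1), |K k| := fun k hk =>
      ((hK k hk t ht x).trans (le_abs_self _)).trans
        (Finset.single_le_sum (f := fun k => |K k|) (fun _ _ => abs_nonneg _)
          (Finset.mem_range.2 (Nat.lt_succ_of_le hk)))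
    exact abs_partialSups_le hle
  symm t i j x hi hj := by
    apply le_antisymm
    · refine partialSups_le_iff.2 fun k hk => ?_
      rw [(h k hk).symm t i j x hi hj]
      exact le_partialSups_of_le (fun k => Φ k t x) hk
    · refine partialSups_le_iff.2 fun k hk => ?_
      rw [← (h k hk).symm t i j x hi hj]
      exact le_partialSups_of_le (fun k => Φ k t (x ∘ Equiv.swap i j)) hk
  succ_le t ht x := by
    refine partialSups_le_iff.2 fun k hk => ((h k hk).succ_le t ht x).trans ?_
    refine Finset.sum_le_sum fun i _ => mul_le_mul_of_nonneg_left ?_ (by positivity)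
    exact le_partialSups_of_le (fun k => Φ k t (x ∘ Equiv.swap i t)) hk

lemma integral_mul_le {Φ : ℕ → (ℕ → α) → ℝ} (h : IsEmpiricalConvex Φ) {ν : Measure (ℕ → α)}
    [IsProbabilityMeasure ν] (hν : IsExchangeable ν) {t : ℕ} (ht : 1 ≤ t) {w : (ℕ → α) → ℝ}
    (mw : Measurable w) (w0 : ∀ x, 0 ≤ w x) {C : ℝ} (hw : ∀ x, w x ≤ C)
    (ws : ∀ i j x, i < t + 1 → j < t + 1 → w (x ∘ Equiv.swap i j) = w x) :
    ∫ x, w x * Φ (t + 1) x ∂ν ≤ ∫ x, w x * Φ t x ∂ν := by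
  obtain ⟨K, hK⟩ := h.bounded
  have iw : ∀ t, 1 ≤ t → Integrable (fun x => w x * Φ t x) ν := fun t ht => by
    refine integrable_of_measurable_of_bound (mw.mul (h.measurable t ht)) (K := C * K) fun x => ?_
    rw [abs_mul, abs_of_nonneg (w0 x)]
    exact mul_le_mul (hw x) (hK t ht x) (abs_nonneg _) ((w0 x).trans (hw x))
  have hi : ∀ i, Integrable (fun x => w (x ∘ Equiv.swap i t) * Φ t (x ∘ Equiv.swap i t)) ν :=
    fun i => (hν i t).integrable_comp_of_integrable (iw t ht)
  calc ∫ x, w x * Φ (t + 1) x ∂ν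
      ≤ ∫ x, ∑ i ∈ Finset.range (t + 1), ((t + 1 : ℕ) : ℝ)⁻¹ *
          (w (x ∘ Equiv.swap i t) * Φ t (x ∘ Equiv.swap i t)) ∂ν := by
        refine integral_mono (iw _ (by omega))
          (integrable_finsetSum _ fun i _ => (hi i).const_mul _) fun x => ?_
        refine (mul_le_mul_of_nonneg_left (h.succ_le t ht x) (w0 x)).trans (le_of_eq ?_)
        rw [Finset.mul_sum]
        refine Finset.sum_congr rfl fun i hi => ?_
        rw [ws i t x (Finset.mem_range.1 hi) (by omega)]
        ring
    _ = ∑ i ∈ Finset.range (t + 1), ((t + 1 : ℕ) : ℝ)⁻¹ * ∫ x, w x * Φ t x ∂ν := by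
        rw [integral_finsetSum _ fun i _ => (hi i).const_mul _]
        refine Finset.sum_congr rfl fun i _ => ?_
        rw [integral_const_mul]
        congr 1
        have := (hν i t).map_eq
        conv_rhs => rw [← this]
        rw [integral_map (hν i t).measurable.aemeasurable]
        exact (mw.mul (h.measurable t ht)).aestronglyMeasurable
    _ = _ := by
        rw [Finset.sum_const, Finset.card_range, nsmul_eq_mul]
        field_simp

lemma integral_le_of_le {Φ : ℕ → (ℕ → α) → ℝ} (h : IsEmpiricalConvex Φ) {ν : Measure (ℕ → α)}
    [IsProbabilityMeasure ν] (hν : IsExchangeable ν) {t t' : ℕ} (ht : 1 ≤ t) (htt : t ≤ t') :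
    ∫ x, Φ t' x ∂ν ≤ ∫ x, Φ t x ∂ν := by
  induction t', htt using Nat.le_induction with
  | base => exact le_rfl
  | succ k hk ih =>
    refine le_trans ?_ ih
    have := h.integral_mul_le hν (ht.trans hk) (w := fun _ => 1) measurable_const
      (fun _ => zero_le_one) (fun _ => le_rfl) (fun _ _ _ _ _ => rfl)
    simpa using this

variable {Φ : ℕ → (ℕ → α) → ℝ} {ν : Measure (ℕ → α)} {a : ℕ}

lemma measurable_runningMax (h : IsEmpiricalConvex Φ) (ha : 1 ≤ a) (n k : ℕ) (hk : k ≤ n) :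
    Measurable fun x => partialSups (fun k => Φ (a + n - k) x) k := by
  induction k with
  | zero => simpa using h.measurable (a + n) (by omega)
  | succ k ih =>
    simp only [partialSups_add_one]
    exact (ih (by omega)).sup (h.measurable _ (by omega))

lemma runningMax_comp_swap (h : IsEmpiricalConvex Φ) (n k : ℕ) (hk : k ≤ n) (x : ℕ → α)
    {i j : ℕ} (hi : i < a + n - k) (hj : j < a + n - k) :
    partialSups (fun k => Φ (a + n - k) (x ∘ Equiv.swap i j)) k =
      partialSups (fun k => Φ (a + n - k) x) k := by
  have e : ∀ m ≤ k, Φ (a + n - m) (x ∘ Equiv.swap i j) = Φ (a + n - m) x := fun m hm =>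
    h.symm _ i j x (by omega) (by omega)
  apply le_antisymm
  · refine partialSups_le_iff.2 fun m hm => ?_
    rw [e m hm]
    exact le_partialSups_of_le (fun k => Φ (a + n - k) x) hm
  · refine partialSups_le_iff.2 fun m hm => ?_
    rw [← e m hm]
    exact le_partialSups_of_le (fun k => Φ (a + n - k) (x ∘ Equiv.swap i j)) hm

lemma integral_sum_weight_nonneg (h : IsEmpiricalConvex Φ) [IsProbabilityMeasure ν]
    (hν : IsExchangeable ν) (ha : 1 ≤ a) (n : ℕ) {w : ℕ → (ℕ → α) → ℝ}
    (mw : ∀ k < n, Measurable (w k)) (w0 : ∀ k < n, ∀ x, 0 ≤ w k x) {C : ℝ}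
    (hw : ∀ k < n, ∀ x, w k x ≤ C)
    (ws : ∀ k < n, ∀ i j x, i < a + n - k → j < a + n - k → w k (x ∘ Equiv.swap i j) = w k x) :
    Integrable (fun x => ∑ k ∈ Finset.range n,
      w k x * (Φ (a + n - (k + 1)) x - Φ (a + n - k) x)) ν ∧
    0 ≤ ∫ x, ∑ k ∈ Finset.range n, w k x * (Φ (a + n - (k + 1)) x - Φ (a + n - k) x) ∂ν := by
  obtain ⟨K, hK⟩ := h.bounded
  have iw : ∀ k < n, ∀ t, 1 ≤ t → Integrable (fun x => w k x * Φ t x) ν := fun k hk t ht => by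
    refine integrable_of_measurable_of_bound ((mw k hk).mul (h.measurable t ht)) (K := C * K)
      fun x => ?_
    rw [abs_mul, abs_of_nonneg (w0 k hk x)]
    exact mul_le_mul (hw k hk x) (hK t ht x) (abs_nonneg _) ((w0 k hk x).trans (hw k hk x))
  have ii : ∀ k ∈ Finset.range n, Integrable (fun x =>
      w k x * (Φ (a + n - (k + 1)) x - Φ (a + n - k) x)) ν := fun k hk => by
    have hk := Finset.mem_range.1 hk
    simp only [mul_sub]
    exact (iw k hk _ (by omega)).sub (iw k hk _ (by omega))
  refine ⟨integrable_finsetSum _ ii, ?_⟩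
  rw [integral_finsetSum _ ii]
  refine Finset.sum_nonneg fun k hk => ?_
  have hk := Finset.mem_range.1 hk
  simp only [mul_sub]
  rw [integral_sub (iw k hk _ (by omega)) (iw k hk _ (by omega)), sub_nonneg]
  have e : a + n - k = a + n - (k + 1) + 1 := by omega
  have hs := ws k hk
  rw [e] at hs ⊢
  exact h.integral_mul_le hν (by omega) (mw k hk) (w0 k hk) (hw k hk) hs

/-- Weak type maximal inequality. -/
lemma mul_measureReal_le (h : IsEmpiricalConvex Φ) (h0 : ∀ t x, 0 ≤ Φ t x) [IsProbabilityMeasure ν]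
    (hν : IsExchangeable ν) (ha : 1 ≤ a) (n : ℕ) (r : ℝ) :
    r * ν.real {x | r ≤ partialSups (fun k => Φ (a + n - k) x) n} ≤ ∫ x, Φ a x ∂ν := by
  have mS := fun k hk => h.measurable_runningMax ha n k hk
  obtain ⟨hi, hn⟩ := h.integral_sum_weight_nonneg (ν := ν) hν ha n
    (w := fun k x => if r ≤ partialSups (fun k => Φ (a + n - k) x) k then 1 else 0)
    (fun k hk => Measurable.ite (measurableSet_le measurable_const (mS k hk.le))
      measurable_const measurable_const)
    (fun k hk x => by split_ifs <;> norm_num) (C := 1)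
    (fun k hk x => by split_ifs <;> norm_num)
    (fun k hk i j x hi hj => by rw [h.runningMax_comp_swap n k hk.le x hi hj])
  set A := {x | r ≤ partialSups (fun k => Φ (a + n - k) x) n} with hA
  have mA : MeasurableSet A := measurableSet_le measurable_const (mS n le_rfl)
  have iA : Integrable (A.indicator fun _ => (1 : ℝ)) ν := (integrable_const _).indicator mA
  have hpt : ∀ x, r * A.indicator (fun _ => (1 : ℝ)) x ≤ Φ a x - ∑ k ∈ Finset.range n,
      (if r ≤ partialSups (fun k => Φ (a + n - k) x) k then 1 else 0) *
        (Φ (a + n - (k + 1)) x - Φ (a + n - k) x) := by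
    intro x
    have := sum_indicator_mul_sub_le (fun k => Φ (a + n - k) x) r n
    simp only [Nat.add_sub_cancel] at this
    by_cases hx : x ∈ A
    · have hx' : r ≤ partialSups (fun k => Φ (a + n - k) x) n := hx
      rw [if_pos hx'] at this
      rw [Set.indicator_of_mem hx]
      linarith
    · have hx' : ¬ r ≤ partialSups (fun k => Φ (a + n - k) x) n := hx
      rw [if_neg hx'] at this
      rw [Set.indicator_of_notMem hx]
      linarith [h0 a x]
  have := integral_mono (iA.const_mul r) ((h.integrable ha).sub hi) hpt
  rw [integral_const_mul, integral_indicator_const _ mA, integral_sub' (h.integrable ha) hi] at this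
  simp only [smul_eq_mul, mul_one] at this
  linarith

/-- `L²` maximal inequality. -/
lemma integral_sq_runningMax_le (h : IsEmpiricalConvex Φ) (h0 : ∀ t x, 0 ≤ Φ t x)
    [IsProbabilityMeasure ν] (hν : IsExchangeable ν) (ha : 1 ≤ a) (n : ℕ) :
    ∫ x, (partialSups (fun k => Φ (a + n - k) x) n) ^ 2 ∂ν ≤ 4 * ∫ x, Φ a x ^ 2 ∂ν := by
  obtain ⟨K, hK⟩ := h.bounded
  have mS := fun k hk => h.measurable_runningMax ha n k hk
  obtain ⟨hi, hn⟩ := h.integral_sum_weight_nonneg (ν := ν) hν ha n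
    (w := fun k x => partialSups (fun k => Φ (a + n - k) x) k)
    (fun k hk => mS k hk.le)
    (fun k hk x => (h0 _ x).trans (le_partialSups_of_le (fun k => Φ (a + n - k) x) k.zero_le))
    (C := K)
    (fun k hk x => (le_abs_self _).trans (abs_partialSups_le fun m hm => hK _ (by omega) x))
    (fun k hk i j x hi hj => h.runningMax_comp_swap n k hk.le x hi hj)
  have hsq : ∀ {f : (ℕ → α) → ℝ}, Measurable f → (∀ x, |f x| ≤ K) →
      Integrable (fun x => f x ^ 2) ν := fun mf hf =>
    integrable_of_measurable_of_bound (mf.pow_const 2) (K := K ^ 2) fun x => by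
      rw [abs_pow]
      exact pow_le_pow_left₀ (abs_nonneg _) (hf x) 2
  have i1 := hsq (mS n le_rfl) fun x => abs_partialSups_le fun m hm => hK _ (by omega) x
  have i2 := hsq (h.measurable a ha) (hK a ha)
  have := integral_mono (i1.add (hi.const_mul 4)) (i2.const_mul 4) fun x => by
    have := sq_partialSups_add_le (fun k => Φ (a + n - k) x) n
    simp only [Nat.add_sub_cancel] at this
    exact this
  rw [integral_add' i1 (hi.const_mul 4), integral_const_mul, integral_const_mul] at this
  linarith

end IsEmpiricalConvex

end Exchangeable

section BoundedDifferences

variable {α : Type*} [MeasurableSpace α]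

/-- Hoeffding's lemma for a function of bounded oscillation. -/
lemma integral_exp_sub_integral_le (P : Measure α) [IsProbabilityMeasure P] {φ : α → ℝ}
    (hφ : Measurable φ) {B : ℝ} (hB : ∀ a b, |φ a - φ b| ≤ B) (r : ℝ) :
    ∫ a, Real.exp (r * (φ a - ∫ b, φ b ∂P)) ∂P ≤ Real.exp (B ^ 2 * r ^ 2 / 8) := by
  have hne : Nonempty α := nonempty_of_isProbabilityMeasure P
  obtain ⟨a₀⟩ := id hne
  have hle : ∀ a b, φ a ≤ φ b + B := fun a b => by linarith [le_abs_self (φ a - φ b), hB a b]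
  have B0 : 0 ≤ B := by simpa using hB a₀ a₀
  have hbdd : BddBelow (Set.range φ) := ⟨φ a₀ - B, by rintro _ ⟨b, rfl⟩; linarith [hle a₀ b]⟩
  have hmem : ∀ a, φ a ∈ Set.Icc (⨅ b, φ b) ((⨅ b, φ b) + B) := fun a =>
    ⟨ciInf_le hbdd a, by
      have : φ a - B ≤ ⨅ b, φ b := le_ciInf fun b => by linarith [hle a b]
      linarith⟩
  have h := (hasSubgaussianMGF_of_mem_Icc (μ := P) hφ.aemeasurable
    (Filter.Eventually.of_forall hmem)).mgf_le r
  rw [mgf] at h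
  refine h.trans (le_of_eq ?_)
  congr 1
  push_cast
  rw [add_sub_cancel_left, Real.norm_eq_abs, abs_of_nonneg B0]
  ring

/-- McDiarmid's inequality in exponential form, for finitely many i.i.d. variables. -/
lemma integral_exp_sub_integral_pi_le (P : Measure α) [IsProbabilityMeasure P] {B : ℝ} (r : ℝ)
    (n : ℕ) (G : (Fin n → α) → ℝ) (hG : Measurable G) (hb : ∃ K, ∀ x, |G x| ≤ K)
    (hB : ∀ x i e, |G (Function.update x i e) - G x| ≤ B) :
    ∫ x, Real.exp (r * (G x - ∫ z, G z ∂(Measure.pi fun _ => P))) ∂(Measure.pi fun _ => P)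
      ≤ Real.exp (n * B ^ 2 * r ^ 2 / 8) := by
  induction n with
  | zero =>
    have : ∀ x, G x = G default := fun x => by rw [Subsingleton.elim x default]
    simp [this]
  | succ n ih =>
    obtain ⟨K, hK⟩ := hb
    have mp := (measurePreserving_piFinSuccAbove (fun _ : Fin (n + 1) => P) 0).symm
    have hs : ∀ z : α × (Fin n → α), (MeasurableEquiv.piFinSuccAbove (fun _ => α) 0).symm z =
        (Fin.cons z.1 z.2 : Fin (n + 1) → α) := fun z => Fin.insertNth_zero' z.1 z.2
    have tr : ∀ F : (Fin (n + 1) → α) → ℝ, ∫ x, F x ∂(Measure.pi fun _ => P) =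
        ∫ z : α × (Fin n → α), F (Fin.cons z.1 z.2) ∂(P.prod (Measure.pi fun _ => P)) := by
      intro F
      rw [← mp.integral_comp' F]
      simp only [hs]
    have mG : Measurable fun z : α × (Fin n → α) =>
        G (Fin.cons (α := fun _ => α) z.1 z.2) := by
      simp only [← hs]
      exact hG.comp (MeasurableEquiv.piFinSuccAbove (fun _ : Fin (n + 1) => α) 0).symm.measurable
    set H : (Fin n → α) → ℝ := fun x => ∫ a, G (Fin.cons (α := fun _ => α) a x) ∂P with hH
    have mH : Measurable H :=
      (StronglyMeasurable.integral_prod_left (μ := P)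
        (f := fun a (x : Fin n → α) => G (Fin.cons (α := fun _ => α) a x))
        mG.stronglyMeasurable).measurable
    have is : ∀ x, Integrable (fun a => G (Fin.cons (α := fun _ => α) a x)) P := fun x =>
      integrable_of_measurable_of_bound (mG.comp measurable_prodMk_right) (fun a => hK _)
    have HK : ∀ x, |H x| ≤ K := fun x => by
      simpa using norm_integral_le_of_norm_le_const (μ := P)
        (f := fun a => G (Fin.cons (α := fun _ => α) a x)) (C := K)
        (Filter.Eventually.of_forall fun a => hK _)
    have HB : ∀ x i e, |H (Function.update x i e) - H x| ≤ B := by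
      intro x i e
      simp only [hH]
      rw [← integral_sub (is _) (is _)]
      have := norm_integral_le_of_norm_le_const (μ := P) (C := B)
        (f := fun a => G (Fin.cons (α := fun _ => α) a (Function.update x i e)) -
          G (Fin.cons (α := fun _ => α) a x))
        (Filter.Eventually.of_forall fun a => by
          rw [Fin.cons_update]; exact hB _ _ _)
      simpa using this
    have hm : ∫ z, G z ∂(Measure.pi fun _ => P) = ∫ x, H x ∂(Measure.pi fun _ => P) := by
      rw [tr, integral_prod_symm _ (integrable_of_measurable_of_bound mG fun z => hK _)]
    set m := ∫ x, H x ∂(Measure.pi fun _ => P) with hmd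
    rw [hm, tr]
    have hexpb : ∀ y : ℝ, |y| ≤ K → |Real.exp (r * (y - m))| ≤ Real.exp (|r| * (K + |m|)) := by
      intro y hy
      rw [abs_of_pos (Real.exp_pos _)]
      refine Real.exp_le_exp.2 ((le_abs_self _).trans ?_)
      rw [abs_mul]
      gcongr
      exact (abs_sub _ _).trans (by gcongr)
    rw [integral_prod_symm _ (integrable_of_measurable_of_bound
      (((mG.sub_const m).const_mul r).exp) fun z => hexpb _ (hK _))]
    have hin : ∀ x, ∫ a, Real.exp (r * (G (Fin.cons (α := fun _ => α) a x) - m)) ∂P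
        ≤ Real.exp (r * (H x - m)) * Real.exp (B ^ 2 * r ^ 2 / 8) := by
      intro x
      have h1 := integral_exp_sub_integral_le P (φ := fun a => G (Fin.cons (α := fun _ => α) a x))
        (mG.comp measurable_prodMk_right) (B := B) (fun a b => by
          have := hB (Fin.cons (α := fun _ => α) b x) 0 a
          rwa [Fin.update_cons_zero] at this) r
      refine le_trans (le_of_eq ?_) (mul_le_mul_of_nonneg_left h1 (Real.exp_pos _).le)
      rw [← integral_const_mul]
      refine integral_congr_ae (Filter.Eventually.of_forall fun a => ?_)
      simp only [hH]
      rw [← Real.exp_add]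
      congr 1
      ring
    have iH : Integrable (fun x => Real.exp (r * (H x - m))) (Measure.pi fun _ : Fin n => P) :=
      integrable_of_measurable_of_bound (((mH.sub_const m).const_mul r).exp)
        fun z => hexpb _ (HK _)
    have mE : Measurable fun z : α × (Fin n → α) =>
        Real.exp (r * (G (Fin.cons (α := fun _ => α) z.1 z.2) - m)) :=
      ((mG.sub_const m).const_mul r).exp
    calc _ ≤ ∫ x, Real.exp (r * (H x - m)) * Real.exp (B ^ 2 * r ^ 2 / 8)
          ∂(Measure.pi fun _ : Fin n => P) := by
          refine integral_mono ?_ (iH.mul_const _) hin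
          exact (integrable_of_measurable_of_bound mE fun z => hexpb _ (hK _)).integral_prod_right
      _ ≤ Real.exp (n * B ^ 2 * r ^ 2 / 8) * Real.exp (B ^ 2 * r ^ 2 / 8) := by
          rw [integral_mul_const]
          exact mul_le_mul_of_nonneg_right (ih H mH ⟨K, HK⟩ HB) (Real.exp_pos _).le
      _ = _ := by
          rw [← Real.exp_add]
          congr 1
          push_cast
          ring

/-- McDiarmid's inequality in exponential form, for a function of the first `n` terms of an i.i.d.
sequence. -/
lemma integral_exp_sub_integral_infinitePi_le (P : Measure α) [IsProbabilityMeasure P] {B : ℝ}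
    (r : ℝ) (n : ℕ) {G : (ℕ → α) → ℝ} (hG : Measurable G) {K : ℝ} (hb : ∀ x, |G x| ≤ K)
    (hdep : ∀ x x', (∀ i < n, x i = x' i) → G x = G x')
    (hB : ∀ x i e, |G (Function.update x i e) - G x| ≤ B) :
    ∫ x, Real.exp (r * (G x - ∫ z, G z ∂(Measure.infinitePi fun _ : ℕ => P)))
      ∂(Measure.infinitePi fun _ : ℕ => P) ≤ Real.exp (n * B ^ 2 * r ^ 2 / 8) := by
  obtain ⟨e⟩ : Nonempty α := nonempty_of_isProbabilityMeasure P
  set ext : (Fin n → α) → ℕ → α := fun z i => if h : i < n then z ⟨i, h⟩ else e with hext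
  have mext : Measurable ext := measurable_pi_lambda _ fun i => by
    by_cases h : i < n
    · simpa [hext, h] using measurable_pi_apply _
    · simp [hext, h]
  set res : (ℕ → α) → Fin n → α := fun x i => x i with hres
  have mres : Measurable res := measurable_pi_lambda _ fun i => measurable_pi_apply _
  have hmap : (Measure.infinitePi fun _ : ℕ => P).map res = Measure.pi fun _ => P := by
    rw [← Measure.infinitePi_eq_pi]
    exact Measure.map_infinitePi_infinitePi_of_inj (P := fun _ => P) Fin.val_injective
  have hGr : ∀ x, G x = (G ∘ ext) (res x) := fun x => hdep _ _ fun i hi => by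
    simp [hext, hres, hi]
  have tr : ∀ F : (Fin n → α) → ℝ, Measurable F →
      ∫ x, F (res x) ∂(Measure.infinitePi fun _ : ℕ => P) = ∫ z, F z ∂(Measure.pi fun _ => P) := by
    intro F hF
    rw [← hmap, integral_map mres.aemeasurable hF.aestronglyMeasurable]
  have mG := hG.comp mext
  have key := integral_exp_sub_integral_pi_le P (B := B) r n (G ∘ ext) mG ⟨K, fun x => hb _⟩
    (fun x i a => by
      have : ext (Function.update x i a) = Function.update (ext x) i a := by
        ext k
        by_cases hk : k = i
        · subst hk; simp [hext]
        · by_cases hkn : k < n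
          · have : (⟨k, hkn⟩ : Fin n) ≠ i := fun h => hk (by rw [← h])
            simp [hext, hk, hkn, this]
          · simp [hext, hk, hkn]
      simp only [Function.comp, this]
      exact hB _ _ _)
  simp_rw [hGr]
  rw [tr _ mG, tr (fun z => Real.exp (r * ((G ∘ ext) z - ∫ z, (G ∘ ext) z
    ∂(Measure.pi fun _ => P)))) ((mG.sub_const _).const_mul r).exp]
  exact key

end BoundedDifferences

section EmpiricalCost

variable {α : Type*} [MeasurableSpace α]

/-- The optimal transport cost between two empirical measures, as a real number. -/
noncomputable def empCost (c : α → α → ℝ≥0) (t s : ℕ) (x y : ℕ → α) : ℝ :=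
  (otCost c (empMeasure x t) (empMeasure y s)).toReal

lemma empCost_swap {c : α → α → ℝ≥0} (hc : Measurable (Function.uncurry c)) (t s : ℕ)
    (x y : ℕ → α) : empCost c t s x y = empCost (fun a b => c b a) s t y x := by
  rw [empCost, otCost_swap hc]; rfl

lemma empCost_nonneg (c : α → α → ℝ≥0) (t s : ℕ) (x y : ℕ → α) : 0 ≤ empCost c t s x y :=
  ENNReal.toReal_nonneg

variable {c : α → α → ℝ≥0} {Δ : ℝ≥0} {t s : ℕ}

lemma otCost_empMeasure_ne_top (hΔ : ∀ x y, c x y ≤ Δ) (ht : 1 ≤ t) (hs : 1 ≤ s) (x y : ℕ → α) :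
    otCost c (empMeasure x t) (empMeasure y s) ≠ ∞ := by
  have := isProbabilityMeasure_empMeasure x ht
  have := isProbabilityMeasure_empMeasure y hs
  exact ne_top_of_le_ne_top ENNReal.coe_ne_top (otCost_le hΔ _ _)

lemma empCost_le (hΔ : ∀ x y, c x y ≤ Δ) (ht : 1 ≤ t) (hs : 1 ≤ s) (x y : ℕ → α) :
    empCost c t s x y ≤ Δ := by
  have := isProbabilityMeasure_empMeasure x ht
  have := isProbabilityMeasure_empMeasure y hs
  exact ENNReal.toReal_le_coe_of_le_coe (otCost_le hΔ _ _)

lemma abs_empCost_le (hΔ : ∀ x y, c x y ≤ Δ) (ht : 1 ≤ t) (hs : 1 ≤ s) (x y : ℕ → α) :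
    |empCost c t s x y| ≤ Δ := by
  rw [abs_of_nonneg (empCost_nonneg _ _ _ _ _)]
  exact empCost_le hΔ ht hs x y

lemma empCost_congr {x x' : ℕ → α} (h : ∀ i < t, x i = x' i) (y : ℕ → α) :
    empCost c t s x y = empCost c t s x' y := by
  have : empMeasure x t = empMeasure x' t := by
    simp only [empMeasure]
    congr 1
    exact Finset.sum_congr rfl fun i hi => by rw [h i (Finset.mem_range.1 hi)]
  simp only [empCost, this]

lemma empCost_congr_right (hc : Measurable (Function.uncurry c)) (x : ℕ → α) {y y' : ℕ → α}
    (h : ∀ i < s, y i = y' i) : empCost c t s x y = empCost c t s x y' := by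
  simp only [empCost_swap hc]
  exact empCost_congr h x

variable [MeasurableSingletonClass α]

lemma measurable_empCost (hc : Measurable (Function.uncurry c)) (ht : 1 ≤ t) (s : ℕ) :
    Measurable fun z : (ℕ → α) × (ℕ → α) => empCost c t s z.1 z.2 :=
  (measurable_otCost_empMeasure hc ht s).ennreal_toReal

lemma abs_empCost_update_sub_le (hc : Measurable (Function.uncurry c)) (hΔ : ∀ x y, c x y ≤ Δ)
    (ht : 1 ≤ t) (hs : 1 ≤ s) (x y : ℕ → α) (i : ℕ) (e : α) :
    |empCost c t s (Function.update x i e) y - empCost c t s x y| ≤ Δ / t := by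
  have key : ∀ x x' : ℕ → α, (∀ k, k ≠ i → x k = x' k) →
      empCost c t s x y ≤ empCost c t s x' y + Δ / t := by
    intro x x' h
    have h1 := otCost_empMeasure_le_add hc hΔ (y := y) t s i h
    have h0 : (t : ℝ≥0∞)⁻¹ ≠ ∞ := by simp; omega
    have h2 := ENNReal.toReal_mono (ENNReal.add_ne_top.2
      ⟨otCost_empMeasure_ne_top hΔ ht hs x' y, ENNReal.mul_ne_top ENNReal.coe_ne_top h0⟩) h1
    rw [ENNReal.toReal_add (otCost_empMeasure_ne_top hΔ ht hs x' y)
      (ENNReal.mul_ne_top ENNReal.coe_ne_top h0)] at h2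
    simpa [empCost, div_eq_mul_inv] using h2
  have h1 := key (Function.update x i e) x fun k hk => Function.update_of_ne hk _ _
  have h2 := key x (Function.update x i e) fun k hk => (Function.update_of_ne hk _ _).symm
  rw [abs_le]
  constructor <;> linarith

omit [MeasurableSingletonClass α] in
lemma empCost_succ_le (hΔ : ∀ x y, c x y ≤ Δ) (ht : 1 ≤ t) (hs : 1 ≤ s) (x y : ℕ → α) :
    empCost c (t + 1) s x y ≤ ∑ i ∈ Finset.range (t + 1),
      ((t + 1 : ℕ) : ℝ)⁻¹ * empCost c t s (x ∘ Equiv.swap i t) y := by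
  have := isProbabilityMeasure_empMeasure y hs
  have h := otCost_empMeasure_succ_le hΔ x ht (empMeasure y s)
  have hn : ((t + 1 : ℕ) : ℝ≥0∞)⁻¹ ≠ ∞ := ENNReal.inv_ne_top.2 (Nat.cast_ne_zero.2 t.succ_ne_zero)
  have hne : ∀ i ∈ Finset.range (t + 1), ((t + 1 : ℕ) : ℝ≥0∞)⁻¹ *
      otCost c (empMeasure (x ∘ Equiv.swap i t) t) (empMeasure y s) ≠ ∞ := fun i _ =>
    ENNReal.mul_ne_top hn (otCost_empMeasure_ne_top hΔ ht hs _ y)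
  refine (ENNReal.toReal_mono (ENNReal.sum_ne_top.2 hne) h).trans (le_of_eq ?_)
  rw [ENNReal.toReal_sum hne]
  refine Finset.sum_congr rfl fun i _ => ?_
  rw [ENNReal.toReal_mul, ENNReal.toReal_inv, ENNReal.toReal_natCast, empCost]

lemma isEmpiricalConvex_empCost (hc : Measurable (Function.uncurry c)) (hΔ : ∀ x y, c x y ≤ Δ)
    (hs : 1 ≤ s) (y : ℕ → α) : IsEmpiricalConvex fun t x => empCost c t s x y := by
  have h1 : ∀ t, 1 ≤ t → Measurable fun x => empCost c t s x y := fun t ht => by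
    have hy : Measurable fun x : ℕ → α => (x, y) := by fun_prop
    have h := (measurable_empCost hc ht s).comp hy
    exact h
  have h2 : ∀ t i j x, i < t → j < t →
      empCost c t s (x ∘ Equiv.swap i j) y = empCost c t s x y := fun t i j x hi hj => by
    simp only [empCost, empMeasure_comp_swap x hi hj]
  exact ⟨h1, ⟨Δ, fun t ht x => abs_empCost_le hΔ ht hs x y⟩, h2,
    fun t ht x => empCost_succ_le hΔ ht hs x y⟩

lemma isEmpiricalConvex_empCost_right (hc : Measurable (Function.uncurry c))
    (hΔ : ∀ x y, c x y ≤ Δ) (ht : 1 ≤ t) (x : ℕ → α) :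
    IsEmpiricalConvex fun s y => empCost c t s x y := by
  simp only [empCost_swap hc]
  exact isEmpiricalConvex_empCost (c := fun a b => c b a) (hc.comp measurable_swap) (fun a b => hΔ b a) ht x

lemma abs_empCost_update_right_sub_le (hc : Measurable (Function.uncurry c))
    (hΔ : ∀ x y, c x y ≤ Δ) (ht : 1 ≤ t) (hs : 1 ≤ s) (x y : ℕ → α) (i : ℕ) (e : α) :
    |empCost c t s x (Function.update y i e) - empCost c t s x y| ≤ Δ / s := by
  simp only [empCost_swap hc]
  exact abs_empCost_update_sub_le (c := fun a b => c b a) (hc.comp measurable_swap)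
    (fun a b => hΔ b a) hs ht y x i e

/-- The mean of the cost between empirical measures is nonincreasing in both sample sizes. -/
lemma integral_empCost_antitone (hc : Measurable (Function.uncurry c)) (hΔ : ∀ x y, c x y ≤ Δ)
    {ν₁ ν₂ : Measure (ℕ → α)} [IsProbabilityMeasure ν₁] [IsProbabilityMeasure ν₂]
    (h₁ : IsExchangeable ν₁) (h₂ : IsExchangeable ν₂) {t' s' : ℕ} (ht : 1 ≤ t) (hs : 1 ≤ s)
    (htt : t ≤ t') (hss : s ≤ s') :
    ∫ z, empCost c t' s' z.1 z.2 ∂(ν₁.prod ν₂) ≤ ∫ z, empCost c t s z.1 z.2 ∂(ν₁.prod ν₂) := by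
  have hi : ∀ {t s : ℕ}, 1 ≤ t → 1 ≤ s →
      Integrable (fun z : (ℕ → α) × (ℕ → α) => empCost c t s z.1 z.2) (ν₁.prod ν₂) :=
    fun ht hs => integrable_of_measurable_of_bound (measurable_empCost hc ht _)
      fun z => abs_empCost_le hΔ ht hs z.1 z.2
  have ht' := ht.trans htt
  have hs' := hs.trans hss
  calc _ ≤ ∫ z, empCost c t s' z.1 z.2 ∂(ν₁.prod ν₂) := by
        rw [integral_prod_symm _ (hi ht' hs'), integral_prod_symm _ (hi ht hs')]
        exact integral_mono (hi ht' hs').integral_prod_right (hi ht hs').integral_prod_right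
          fun y => (isEmpiricalConvex_empCost hc hΔ hs' y).integral_le_of_le h₁ ht htt
    _ ≤ _ := by
        rw [integral_prod _ (hi ht hs'), integral_prod _ (hi ht hs)]
        exact integral_mono (hi ht hs').integral_prod_left (hi ht hs).integral_prod_left
          fun x => (isEmpiricalConvex_empCost_right hc hΔ ht x).integral_le_of_le h₂ hs hss

end EmpiricalCost

section UniformHoeffding

variable {α : Type*} [MeasurableSpace α]

lemma isEmpiricalConvex_neg_average {f : α → ℝ} (hf : Measurable f) {K : ℝ}
    (hK : ∀ x, |f x| ≤ K) :
    IsEmpiricalConvex fun t (x : ℕ → α) => -((∑ i ∈ Finset.range t, f (x i)) / t) where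
  measurable t _ :=
    ((Finset.measurable_sum _ fun i _ => hf.comp (measurable_pi_apply i)).div_const _).neg
  bounded := by
    refine ⟨K, fun t ht x => ?_⟩
    have ht' : (0 : ℝ) < t := by exact_mod_cast ht
    rw [abs_neg, abs_div, Nat.abs_cast, div_le_iff₀ ht']
    refine (Finset.abs_sum_le_sum_abs _ _).trans ((Finset.sum_le_sum fun i _ => hK (x i)).trans ?_)
    rw [Finset.sum_const, Finset.card_range, nsmul_eq_mul, mul_comm]
  symm t i j x hi hj := by
    congr 2
    refine Finset.sum_equiv (Equiv.swap i j) (fun k => ?_) (fun _ _ => rfl)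
    by_cases h1 : k = i
    · simp [h1, hi, hj]
    by_cases h2 : k = j
    · simp [h2, hi, hj]
    rw [Equiv.swap_apply_of_ne_of_ne h1 h2]
  succ_le t ht x := by
    have ht' : (0 : ℝ) < t := by exact_mod_cast ht
    have := sum_sum_swap (fun k => f (x k)) t
    simp only [Function.comp]
    rw [← Finset.mul_sum, Finset.sum_neg_distrib, ← Finset.sum_div, this, nsmul_eq_mul]
    refine le_of_eq ?_
    push_cast
    field_simp

lemma integral_average_infinitePi (P : Measure α) [IsProbabilityMeasure P] {f : α → ℝ}
    (hf : Measurable f) {K : ℝ} (hK : ∀ x, |f x| ≤ K) {t : ℕ} (ht : 1 ≤ t) :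
    ∫ x, -((∑ i ∈ Finset.range t, f (x i)) / t) ∂(Measure.infinitePi fun _ : ℕ => P)
      = -∫ e, f e ∂P := by
  have ht' : (0 : ℝ) < t := by exact_mod_cast ht
  have hi : ∀ i ∈ Finset.range t, Integrable (fun x : ℕ → α => f (x i))
      (Measure.infinitePi fun _ : ℕ => P) := fun i _ =>
    integrable_of_measurable_of_bound (hf.comp (measurable_pi_apply i)) fun x => hK (x i)
  rw [integral_neg, integral_div, integral_finsetSum _ hi]
  have : ∀ i, ∫ x, f (x i) ∂(Measure.infinitePi fun _ : ℕ => P) = ∫ e, f e ∂P := fun i => by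
    have mp := measurePreserving_eval_infinitePi (fun _ : ℕ => P) i
    rw [← mp.map_eq, integral_map mp.measurable.aemeasurable hf.aestronglyMeasurable]
    rw [mp.map_eq]
  simp only [this]
  rw [Finset.sum_const, Finset.card_range, nsmul_eq_mul, mul_div_cancel_left₀ _ ht'.ne']

/-- Maximal Hoeffding inequality for averages over sample sizes in `[a, 2a)`. -/
lemma measureReal_exists_average_le (P : Measure α) [IsProbabilityMeasure P] {f : α → ℝ}
    (hf : Measurable f) {m D : ℝ} (hD : 0 < D) (hfm : ∀ x, f x ∈ Set.Icc m (m + D)) {a : ℕ}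
    (ha : 1 ≤ a) {u : ℝ} (hu : 0 ≤ u) :
    (Measure.infinitePi fun _ : ℕ => P).real {x | ∃ t, a ≤ t ∧ t < 2 * a ∧
      u ≤ ∫ e, f e ∂P - (∑ i ∈ Finset.range t, f (x i)) / t}
      ≤ Real.exp (-(2 * a * u ^ 2 / D ^ 2)) := by
  set ν := Measure.infinitePi fun _ : ℕ => P with hν
  have hK : ∀ x, |f x| ≤ |m| + D := fun x => by
    have := hfm x
    rw [abs_le]; constructor <;> linarith [this.1, this.2, neg_abs_le m, le_abs_self m]
  have ha' : (0 : ℝ) < a := by exact_mod_cast ha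
  set r : ℝ := 4 * a * u / D ^ 2 with hr
  have hr0 : 0 ≤ r := by positivity
  have hΨ := isEmpiricalConvex_neg_average hf hK
  have hΦ := hΨ.exp_mul hr0
  set E := ∫ e, f e ∂P with hE
  have hw := hΦ.mul_measureReal_le (ν := ν) (fun _ _ => (Real.exp_pos _).le)
    (isExchangeable_infinitePi P) ha (a - 1) (Real.exp (r * (u - E)))
  have hsub : {x | ∃ t, a ≤ t ∧ t < 2 * a ∧ u ≤ E - (∑ i ∈ Finset.range t, f (x i)) / t} ⊆
      {x : ℕ → α | Real.exp (r * (u - E)) ≤ partialSups (fun k => Real.exp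
        (r * -((∑ i ∈ Finset.range (a + (a - 1) - k), f (x i)) / (a + (a - 1) - k : ℕ)))) (a - 1)} := by
    rintro x ⟨t, h1, h2, h3⟩
    have hk : a + (a - 1) - (2 * a - 1 - t) = t := by omega
    refine le_trans ?_ (le_partialSups_of_le (fun k => Real.exp
        (r * -((∑ i ∈ Finset.range (a + (a - 1) - k), f (x i)) / (a + (a - 1) - k : ℕ))))
        (i := 2 * a - 1 - t) (by omega))
    simp only [hk]
    exact Real.exp_le_exp.2 (mul_le_mul_of_nonneg_left (by linarith) hr0)
  have hmono := measureReal_mono (μ := ν) hsub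
  have hmc := integral_exp_sub_integral_infinitePi_le P (B := D / a) r a
    (hΨ.measurable a ha) (K := |m| + D) (fun x => by
      rw [abs_neg, abs_div, Nat.abs_cast, div_le_iff₀ ha']
      refine (Finset.abs_sum_le_sum_abs _ _).trans
        ((Finset.sum_le_sum fun i _ => hK (x i)).trans ?_)
      rw [Finset.sum_const, Finset.card_range, nsmul_eq_mul, mul_comm])
    (fun x x' h => by
      congr 2
      exact Finset.sum_congr rfl fun i hi => by rw [h i (Finset.mem_range.1 hi)])
    (fun x i e => by
      rw [neg_sub_neg, ← sub_div, ← Finset.sum_sub_distrib, abs_div, Nat.abs_cast]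
      gcongr
      have hk : ∀ k ∈ Finset.range a, |f (x k) - f (Function.update x i e k)| ≤
          if k = i then D else 0 := fun k _ => by
        by_cases hki : k = i
        · simp only [hki, if_true, Function.update_self]
          rw [abs_le]
          constructor <;> linarith [(hfm (x i)).1, (hfm (x i)).2, (hfm e).1, (hfm e).2]
        · simp [hki]
      refine (Finset.abs_sum_le_sum_abs _ _).trans ((Finset.sum_le_sum hk).trans ?_)
      rw [Finset.sum_ite_eq']
      split_ifs <;> linarith)
  rw [← hν, integral_average_infinitePi P hf hK ha, ← hE] at hmc
  have hfac : ∫ x, Real.exp (r * -((∑ i ∈ Finset.range a, f (x i)) / a)) ∂ν =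
      Real.exp (-(r * E)) * ∫ x, Real.exp (r * (-((∑ i ∈ Finset.range a, f (x i)) / a) - -E)) ∂ν := by
    rw [← integral_const_mul]
    refine integral_congr_ae (Filter.Eventually.of_forall fun x => ?_)
    simp only
    rw [← Real.exp_add]
    congr 1; ring
  rw [hfac] at hw
  have h1 : Real.exp (r * (u - E)) * ν.real {x | ∃ t, a ≤ t ∧ t < 2 * a ∧
      u ≤ E - (∑ i ∈ Finset.range t, f (x i)) / t} ≤
      Real.exp (-(r * E)) * Real.exp (a * (D / a) ^ 2 * r ^ 2 / 8) :=
    (mul_le_mul_of_nonneg_left hmono (Real.exp_pos _).le).trans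
      (hw.trans (mul_le_mul_of_nonneg_left hmc (Real.exp_pos _).le))
  rw [← Real.exp_add, mul_comm, ← le_div_iff₀ (Real.exp_pos _), ← Real.exp_sub] at h1
  refine h1.trans (le_of_eq ?_)
  congr 1
  rw [hr]
  field_simp
  ring

/-- Time-uniform Hoeffding inequality with the stitched boundary `κ`. -/
lemma measure_exists_average_gt_le (P : Measure α) [IsProbabilityMeasure P] {f : α → ℝ}
    (hf : Measurable f) {m D : ℝ} (hD : 0 ≤ D) (hfm : ∀ x, f x ∈ Set.Icc m (m + D))
    {l : ℝ → ℝ} (hl : IsStitchingOne l) {δ : ℝ} (hδ0 : 0 < δ) (hδ1 : δ < 1) :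
    (Measure.infinitePi fun _ : ℕ => P) {x | ∃ t : ℕ, 1 ≤ t ∧
      D * kappaOne l δ t < ∫ e, f e ∂P - (∑ i ∈ Finset.range t, f (x i)) / t}
      ≤ ENNReal.ofReal (δ / 4) := by
  set ν := Measure.infinitePi fun _ : ℕ => P with hν
  set E := ∫ e, f e ∂P with hE
  have hK : ∀ x, |f x| ≤ |m| + D := fun x => by
    have := hfm x
    rw [abs_le]; constructor <;> linarith [this.1, this.2, neg_abs_le m, le_abs_self m]
  have hEle : E ≤ m + D := by
    have := integral_mono (integrable_of_measurable_of_bound (μ := P) hf hK)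
      (integrable_const (m + D)) fun x => (hfm x).2
    simpa using this
  have hlow : ∀ (x : ℕ → α) (t : ℕ), 1 ≤ t → m ≤ (∑ i ∈ Finset.range t, f (x i)) / t := by
    intro x t ht
    have ht' : (0 : ℝ) < t := by exact_mod_cast ht
    rw [le_div_iff₀ ht']
    have := Finset.sum_le_sum (s := Finset.range t) fun i _ => (hfm (x i)).1
    rw [Finset.sum_const, Finset.card_range, nsmul_eq_mul] at this
    linarith
  have hlog : 1 ≤ Real.log (4 / δ) := by
    rw [Real.le_log_iff_exp_le (by positivity)]
    have : (4 : ℝ) ≤ 4 / δ := by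
      rw [le_div_iff₀ hδ0]; linarith
    linarith [Real.exp_one_lt_d9]
  rcases hD.eq_or_lt with hD0 | hD0
  · have : {x : ℕ → α | ∃ t : ℕ, 1 ≤ t ∧
        D * kappaOne l δ t < E - (∑ i ∈ Finset.range t, f (x i)) / t} = ∅ := by
      rw [Set.eq_empty_iff_forall_notMem]
      rintro x ⟨t, ht, h⟩
      rw [← hD0, zero_mul] at h
      linarith [hlow x t ht]
    rw [this, measure_empty]
    exact zero_le
  set L : ℕ → ℝ := fun k => Real.log (l k) + Real.log (4 / δ) with hL
  have hl1 : ∀ k : ℕ, 1 ≤ l k := fun k => hl.one_le _ (Nat.cast_nonneg k)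
  have hL0 : ∀ k, 0 ≤ L k := fun k => add_nonneg (Real.log_nonneg (hl1 k)) (by linarith)
  set B : ℕ → Set (ℕ → α) := fun k => {x | ∃ t, 2 ^ (k + 1) ≤ t ∧ t < 2 * 2 ^ (k + 1) ∧
    D * Real.sqrt (L (k + 1) / (2 * 2 ^ (k + 1))) ≤ E - (∑ i ∈ Finset.range t, f (x i)) / t} with hB
  have hBk : ∀ k, ν (B k) ≤ ENNReal.ofReal (δ / 4) * ENNReal.ofReal (1 / l ((k : ℝ) + 1)) := by
    intro k
    have h := measureReal_exists_average_le P hf hD0 hfm (a := 2 ^ (k + 1)) Nat.one_le_two_pow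
      (u := D * Real.sqrt (L (k + 1) / (2 * 2 ^ (k + 1)))) (by positivity)
    rw [← ENNReal.ofReal_mul (by positivity), ← ofReal_measureReal]
    refine ENNReal.ofReal_le_ofReal (h.trans (le_of_eq ?_))
    rw [mul_pow, Real.sq_sqrt (div_nonneg (hL0 _) (by positivity))]
    have e : -(2 * ((2 ^ (k + 1) : ℕ) : ℝ) * (D ^ 2 * (L (k + 1) / (2 * 2 ^ (k + 1)))) / D ^ 2)
        = -L (k + 1) := by
      push_cast
      field_simp
    have hlp : 0 < l ((k : ℝ) + 1) := by
      have := hl1 (k + 1); push_cast at this; linarith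
    rw [e, hL]
    push_cast
    rw [neg_add, Real.exp_add, Real.exp_neg, Real.exp_neg, Real.exp_log hlp,
      Real.exp_log (by positivity)]
    field_simp
  have hsub : {x : ℕ → α | ∃ t : ℕ, 1 ≤ t ∧
      D * kappaOne l δ t < E - (∑ i ∈ Finset.range t, f (x i)) / t} ⊆ ⋃ k, B k := by
    rintro x ⟨t, ht, h⟩
    have ht0 : (0 : ℝ) < t := by exact_mod_cast ht
    rcases ht.eq_or_lt with ht1 | ht1
    · exfalso
      have hk : 1 ≤ kappaOne l δ t := by
        rw [kappaOne, Real.one_le_sqrt, ← ht1]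
        have := Real.log_nonneg (hl.one_le 0 le_rfl)
        simp
        linarith
      have := mul_le_mul_of_nonneg_left hk hD
      linarith [hlow x t ht]
    · have hlt : 1 ≤ Nat.log 2 t := Nat.log_pos (by norm_num) ht1
      obtain ⟨k, hk⟩ : ∃ k, Nat.log 2 t = k + 1 := ⟨Nat.log 2 t - 1, by omega⟩
      have h1 : 2 ^ (k + 1) ≤ t := by rw [← hk]; exact Nat.pow_log_le_self 2 (by omega)
      have h2 : t < 2 * 2 ^ (k + 1) := by
        have := Nat.lt_pow_succ_log_self (b := 2) (by norm_num) t
        rw [hk, Nat.succ_eq_add_one, pow_succ] at this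
        omega
      refine Set.mem_iUnion.2 ⟨k, t, h1, h2, le_trans ?_ h.le⟩
      refine mul_le_mul_of_nonneg_left (Real.sqrt_le_sqrt ?_) hD
      have hlogb : ((k + 1 : ℕ) : ℝ) ≤ Real.logb 2 t := by
        rw [Real.le_logb_iff_rpow_le (by norm_num) ht0, Real.rpow_natCast]
        exact_mod_cast h1
      have hmon : l ((k + 1 : ℕ) : ℝ) ≤ l (Real.logb 2 t) :=
        hl.mono (Set.mem_Ici.2 (Nat.cast_nonneg _))
          (Set.mem_Ici.2 ((Nat.cast_nonneg _).trans hlogb)) hlogb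
      have hLle : L (k + 1) ≤ Real.log (l (Real.logb 2 t)) + Real.log (4 / δ) :=
        add_le_add (Real.log_le_log (by linarith [hl1 (k + 1)]) hmon) le_rfl
      refine div_le_div₀ ((hL0 _).trans hLle) hLle ht0 ?_
      exact_mod_cast h2.le
  calc _ ≤ ν (⋃ k, B k) := measure_mono hsub
    _ ≤ ∑' k, ν (B k) := measure_iUnion_le _
    _ ≤ ∑' k : ℕ, ENNReal.ofReal (δ / 4) * ENNReal.ofReal (1 / l ((k : ℝ) + 1)) :=
        ENNReal.tsum_le_tsum hBk
    _ ≤ ENNReal.ofReal (δ / 4) * 1 := by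
        rw [ENNReal.tsum_mul_left]
        gcongr
        exact hl.sum_le
    _ = _ := mul_one _

end UniformHoeffding

section UniformUpperDeviation

lemma measurable_partialSups_fun {β : Type*} [MeasurableSpace β] {F : ℕ → β → ℝ} (n : ℕ)
    (h : ∀ k ≤ n, Measurable (F k)) : Measurable fun z => partialSups (fun k => F k z) n := by
  induction n with
  | zero => simpa using h 0 le_rfl
  | succ n ih =>
    simp only [partialSups_add_one]
    exact (ih fun k hk => h k (hk.trans n.le_succ)).sup (h (n + 1) le_rfl)

variable {α : Type*} [MeasurableSpace α] [MeasurableSingletonClass α]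
  {c : α → α → ℝ≥0} {Δ : ℝ≥0}

/-- Exponential moment bound for the cost between empirical measures. -/
lemma integral_exp_empCost_le (hc : Measurable (Function.uncurry c)) (hΔ : ∀ x y, c x y ≤ Δ)
    (P Q : Measure α) [IsProbabilityMeasure P] [IsProbabilityMeasure Q] {a b : ℕ} (ha : 1 ≤ a)
    (hb : 1 ≤ b) (r : ℝ) {E : ℝ}
    (hE : E = ∫ z, empCost c a b z.1 z.2
      ∂((Measure.infinitePi fun _ : ℕ => P).prod (Measure.infinitePi fun _ : ℕ => Q))) :
    ∫ z, Real.exp (r * (empCost c a b z.1 z.2 - E))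
      ∂((Measure.infinitePi fun _ : ℕ => P).prod (Measure.infinitePi fun _ : ℕ => Q))
      ≤ Real.exp (r ^ 2 * Δ ^ 2 * (1 / a + 1 / b) / 8) := by
  set ν₁ := Measure.infinitePi fun _ : ℕ => P with hν₁
  set ν₂ := Measure.infinitePi fun _ : ℕ => Q with hν₂
  have ha' : (0 : ℝ) < a := by exact_mod_cast ha
  have hb' : (0 : ℝ) < b := by exact_mod_cast hb
  have mD := measurable_empCost hc ha b
  have bD := fun (x y : ℕ → α) => abs_empCost_le hΔ ha hb x y
  have iD : Integrable (fun z : (ℕ → α) × (ℕ → α) => empCost c a b z.1 z.2) (ν₁.prod ν₂) :=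
    integrable_of_measurable_of_bound mD fun z => bD z.1 z.2
  set H : (ℕ → α) → ℝ := fun x => ∫ y, empCost c a b x y ∂ν₂ with hH
  have mH : Measurable H :=
    (StronglyMeasurable.integral_prod_right (f := fun x y => empCost c a b x y)
      mD.stronglyMeasurable).measurable
  have mDy : ∀ x, Measurable fun y => empCost c a b x y := fun x =>
    (isEmpiricalConvex_empCost_right hc hΔ ha x).measurable b hb
  have is : ∀ x, Integrable (fun y => empCost c a b x y) ν₂ := fun x =>
    integrable_of_measurable_of_bound (mDy x) fun y => bD x y
  have bH : ∀ x, |H x| ≤ Δ := fun x => by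
    simpa using norm_integral_le_of_norm_le_const (μ := ν₂) (f := fun y => empCost c a b x y)
      (C := Δ) (Filter.Eventually.of_forall fun y => bD x y)
  have hEH : E = ∫ x, H x ∂ν₁ := by rw [hE, integral_prod _ iD]
  have hexpb : ∀ y : ℝ, |y| ≤ Δ → |Real.exp (r * (y - E))| ≤ Real.exp (|r| * (Δ + |E|)) := by
    intro y hy
    rw [abs_of_pos (Real.exp_pos _)]
    refine Real.exp_le_exp.2 ((le_abs_self _).trans ?_)
    rw [abs_mul]
    gcongr
    exact (abs_sub _ _).trans (by gcongr)
  have iE : Integrable (fun z : (ℕ → α) × (ℕ → α) =>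
      Real.exp (r * (empCost c a b z.1 z.2 - E))) (ν₁.prod ν₂) :=
    integrable_of_measurable_of_bound ((mD.sub_const E).const_mul r).exp fun z =>
      hexpb _ (bD z.1 z.2)
  have iH : Integrable (fun x => Real.exp (r * (H x - E))) ν₁ :=
    integrable_of_measurable_of_bound ((mH.sub_const E).const_mul r).exp fun z => hexpb _ (bH z)
  have hin : ∀ x, ∫ y, Real.exp (r * (empCost c a b x y - E)) ∂ν₂ ≤
      Real.exp (r * (H x - E)) * Real.exp (b * (Δ / b) ^ 2 * r ^ 2 / 8) := by
    intro x
    have h1 := integral_exp_sub_integral_infinitePi_le Q (B := Δ / b) r b (mDy x) (bD x)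
      (fun y y' h => empCost_congr_right hc x h)
      (fun y i e => abs_empCost_update_right_sub_le hc hΔ ha hb x y i e)
    refine le_trans (le_of_eq ?_) (mul_le_mul_of_nonneg_left h1 (Real.exp_pos _).le)
    rw [← integral_const_mul]
    refine integral_congr_ae (Filter.Eventually.of_forall fun y => ?_)
    simp only [hH]
    rw [← Real.exp_add]
    congr 1
    ring
  have hout := integral_exp_sub_integral_infinitePi_le P (B := Δ / a) r a mH bH
    (fun x x' h => by
      simp only [hH]
      exact integral_congr_ae (Filter.Eventually.of_forall fun y => empCost_congr h y))
    (fun x i e => by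
      simp only [hH]
      rw [← integral_sub (is _) (is _)]
      simpa using norm_integral_le_of_norm_le_const (μ := ν₂) (C := Δ / a)
        (f := fun y => empCost c a b (Function.update x i e) y - empCost c a b x y)
        (Filter.Eventually.of_forall fun y => abs_empCost_update_sub_le hc hΔ ha hb x y i e))
  rw [← hν₁, ← hEH] at hout
  rw [integral_prod _ iE]
  calc _ ≤ ∫ x, Real.exp (r * (H x - E)) * Real.exp (b * (Δ / b) ^ 2 * r ^ 2 / 8) ∂ν₁ :=
        integral_mono iE.integral_prod_left (iH.mul_const _) hin
    _ ≤ Real.exp (a * (Δ / a) ^ 2 * r ^ 2 / 8) * Real.exp (b * (Δ / b) ^ 2 * r ^ 2 / 8) := by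
        rw [integral_mul_const]
        exact mul_le_mul_of_nonneg_right hout (Real.exp_pos _).le
    _ = _ := by
        rw [← Real.exp_add]
        congr 1
        field_simp

/-- Maximal inequality over a rectangle of sample sizes. -/
lemma measureReal_exists_empCost_le (hc : Measurable (Function.uncurry c)) (hΔ : ∀ x y, c x y ≤ Δ)
    (P Q : Measure α) [IsProbabilityMeasure P] [IsProbabilityMeasure Q] {a b : ℕ} (ha : 1 ≤ a)
    (hb : 1 ≤ b) {r : ℝ} (hr : 0 ≤ r) (u : ℝ) {E : ℝ}
    (hE : E = ∫ z, empCost c a b z.1 z.2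
      ∂((Measure.infinitePi fun _ : ℕ => P).prod (Measure.infinitePi fun _ : ℕ => Q))) :
    ((Measure.infinitePi fun _ : ℕ => P).prod (Measure.infinitePi fun _ : ℕ => Q)).real
      {z | ∃ t s, (a ≤ t ∧ t < 2 * a) ∧ (b ≤ s ∧ s < 2 * b) ∧ u ≤ empCost c t s z.1 z.2 - E}
      ≤ 16 * Real.exp (-(r * u) + r ^ 2 * Δ ^ 2 * (1 / a + 1 / b) / 8) := by
  have hmgf := integral_exp_empCost_le hc hΔ P Q ha hb r hE
  set ν₁ := Measure.infinitePi fun _ : ℕ => P with hν₁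
  set ν₂ := Measure.infinitePi fun _ : ℕ => Q with hν₂
  have hr2 : 0 ≤ r / 2 := by linarith
  set n := a - 1 with hn
  set m := b - 1 with hm
  set W : ℕ → ℕ → (ℕ → α) → (ℕ → α) → ℝ := fun t s x y =>
    Real.exp (r / 2 * empCost c t s x y) with hW
  have W0 : ∀ t s x y, 0 ≤ W t s x y := fun t s x y => (Real.exp_pos _).le
  have Wc : ∀ s y, 1 ≤ s → IsEmpiricalConvex fun t x => W t s x y := fun s y hs =>
    (isEmpiricalConvex_empCost hc hΔ hs y).exp_mul hr2
  have Wc' : ∀ t x, 1 ≤ t → IsEmpiricalConvex fun s y => W t s x y := fun t x ht =>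
    (isEmpiricalConvex_empCost_right hc hΔ ht x).exp_mul hr2
  have mW : ∀ t s, 1 ≤ t → Measurable fun z : (ℕ → α) × (ℕ → α) => W t s z.1 z.2 := fun t s ht =>
    ((measurable_empCost hc ht s).const_mul _).exp
  set K : ℝ := Real.exp (r / 2 * Δ) with hK
  have bW : ∀ t s x y, 1 ≤ t → 1 ≤ s → |W t s x y| ≤ K := fun t s x y ht hs => by
    rw [abs_of_nonneg (W0 _ _ _ _)]
    exact Real.exp_le_exp.2 (mul_le_mul_of_nonneg_left (empCost_le hΔ ht hs x y) hr2)
  set V : ℕ → (ℕ → α) → (ℕ → α) → ℝ := fun t x y =>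
    partialSups (fun j => W t (b + m - j) x y) m with hV
  have V0 : ∀ t x y, 0 ≤ V t x y := fun t x y =>
    (W0 _ _ _ _).trans (le_partialSups_of_le (fun j => W t (b + m - j) x y) m.zero_le)
  have Vc : ∀ y, IsEmpiricalConvex fun t x => V t x y := fun y =>
    IsEmpiricalConvex.partialSups_family (Φ := fun j t x => W t (b + m - j) x y) m
      fun j hj => Wc _ y (by omega)
  have mV : ∀ t, 1 ≤ t → Measurable fun z : (ℕ → α) × (ℕ → α) => V t z.1 z.2 := fun t ht =>
    measurable_partialSups_fun (F := fun j (z : (ℕ → α) × (ℕ → α)) => W t (b + m - j) z.1 z.2) m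
      fun j _ => mW _ _ ht
  have bV : ∀ t x y, 1 ≤ t → |V t x y| ≤ K := fun t x y ht =>
    abs_partialSups_le fun j hj => bW _ _ _ _ ht (by omega)
  set M : (ℕ → α) × (ℕ → α) → ℝ := fun z => partialSups (fun k => V (a + n - k) z.1 z.2) n with hM
  have mM : Measurable M :=
    measurable_partialSups_fun (F := fun k (z : (ℕ → α) × (ℕ → α)) => V (a + n - k) z.1 z.2) n
      fun k hk => mV _ (by omega)
  have bM : ∀ z, |M z| ≤ K := fun z => abs_partialSups_le fun k hk => bV _ _ _ (by omega)
  have isq : ∀ {f : (ℕ → α) × (ℕ → α) → ℝ}, Measurable f → (∀ z, |f z| ≤ K) →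
      Integrable (fun z => f z ^ 2) (ν₁.prod ν₂) := fun mf hf =>
    integrable_of_measurable_of_bound (mf.pow_const 2) (K := K ^ 2) fun x => by
      rw [abs_pow]
      exact pow_le_pow_left₀ (abs_nonneg _) (hf x) 2
  have iM := isq mM bM
  have iV := isq (mV a ha) (fun z => bV a z.1 z.2 ha)
  have iW := isq (mW a b ha) (fun z => bW a b z.1 z.2 ha hb)
  have s1 : ∫ z, M z ^ 2 ∂(ν₁.prod ν₂) ≤ 4 * ∫ z, V a z.1 z.2 ^ 2 ∂(ν₁.prod ν₂) := by
    rw [integral_prod_symm _ iM, integral_prod_symm _ iV, ← integral_const_mul]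
    exact integral_mono iM.integral_prod_right (iV.integral_prod_right.const_mul 4)
      fun y => (Vc y).integral_sq_runningMax_le (fun t x => V0 t x y)
        (isExchangeable_infinitePi P) ha n
  have s2 : ∫ z, V a z.1 z.2 ^ 2 ∂(ν₁.prod ν₂) ≤ 4 * ∫ z, W a b z.1 z.2 ^ 2 ∂(ν₁.prod ν₂) := by
    rw [integral_prod _ iV, integral_prod _ iW, ← integral_const_mul]
    exact integral_mono iV.integral_prod_left (iW.integral_prod_left.const_mul 4)
      fun x => (Wc' a x ha).integral_sq_runningMax_le (fun s y => W0 a s x y)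
        (isExchangeable_infinitePi Q) hb m
  have s3 : ∫ z, W a b z.1 z.2 ^ 2 ∂(ν₁.prod ν₂) ≤
      Real.exp (r * E) * Real.exp (r ^ 2 * Δ ^ 2 * (1 / a + 1 / b) / 8) := by
    refine le_trans (le_of_eq ?_) (mul_le_mul_of_nonneg_left hmgf (Real.exp_pos _).le)
    rw [← integral_const_mul]
    refine integral_congr_ae (Filter.Eventually.of_forall fun z => ?_)
    simp only [hW]
    rw [← Real.exp_nat_mul, ← Real.exp_add]
    congr 1
    push_cast
    ring
  have hmk := mul_meas_ge_le_integral_of_nonneg (Filter.Eventually.of_forall fun z => sq_nonneg (M z))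
    iM (Real.exp (r * (E + u)))
  have hsub : {z : (ℕ → α) × (ℕ → α) | ∃ t s, (a ≤ t ∧ t < 2 * a) ∧ (b ≤ s ∧ s < 2 * b) ∧
      u ≤ empCost c t s z.1 z.2 - E} ⊆ {z | Real.exp (r * (E + u)) ≤ M z ^ 2} := by
    rintro z ⟨t, s, ⟨t1, t2⟩, ⟨s1, s2⟩, h⟩
    have hk : a + n - (2 * a - 1 - t) = t := by omega
    have hj : b + m - (2 * b - 1 - s) = s := by omega
    have l1 : W t s z.1 z.2 ≤ V t z.1 z.2 := by
      have := le_partialSups_of_le (fun j => W t (b + m - j) z.1 z.2) (i := 2 * b - 1 - s) (j := m)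
        (by omega)
      simpa only [hj] using this
    have l2 : V t z.1 z.2 ≤ M z := by
      have := le_partialSups_of_le (fun k => V (a + n - k) z.1 z.2) (i := 2 * a - 1 - t) (j := n)
        (by omega)
      simpa only [hk] using this
    have l3 : Real.exp (r * (E + u)) ≤ W t s z.1 z.2 ^ 2 := by
      simp only [hW]
      rw [← Real.exp_nat_mul]
      refine Real.exp_le_exp.2 ?_
      push_cast
      have := mul_le_mul_of_nonneg_left (show E + u ≤ empCost c t s z.1 z.2 by linarith) hr
      linarith
    exact l3.trans (pow_le_pow_left₀ (W0 _ _ _ _) (l1.trans l2) 2)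
  have hfin := (mul_le_mul_of_nonneg_left (measureReal_mono (μ := ν₁.prod ν₂) hsub)
    (Real.exp_pos (r * (E + u))).le).trans (hmk.trans (show _ ≤ 16 * (Real.exp (r * E) *
      Real.exp (r ^ 2 * Δ ^ 2 * (1 / a + 1 / b) / 8)) by linarith))
  rw [mul_comm, ← le_div_iff₀ (Real.exp_pos _)] at hfin
  refine hfin.trans (le_of_eq ?_)
  rw [mul_div_assoc, ← Real.exp_add, ← Real.exp_sub]
  congr 2
  ring

end UniformUpperDeviation

section StitchedUpperDeviation

lemma tsum_tsum_add_le_six {r : ℕ → ℝ≥0∞} (h : ∑' j : ℕ, ∑' k : ℕ, r (j + 1 + (k + 1)) ≤ 1)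
    (h2 : ∀ n, r n ≤ r 2) : ∑' j : ℕ, ∑' k : ℕ, r (j + k) ≤ 6 := by
  have hrow : ∀ j, ∑' k : ℕ, r (j + 1 + (k + 1)) ≤ 1 := fun j => (ENNReal.le_tsum j).trans h
  have h1 : ∀ n, r n ≤ 1 := fun n =>
    (h2 n).trans ((ENNReal.le_tsum (f := fun k => r (0 + 1 + (k + 1))) 0).trans (hrow 0))
  have hs : ∀ f : ℕ → ℝ≥0∞, ∑' n, f n = f 0 + ∑' n, f (n + 1) := fun f =>
    tsum_eq_zero_add' ENNReal.summable
  have hcol : ∑' k : ℕ, r (k + 1) ≤ 2 := by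
    rw [hs fun k => r (k + 1)]
    have := hrow 0
    simp only [zero_add, add_comm 1] at this ⊢
    exact (add_le_add (h1 1) this).trans (by norm_num)
  rw [hs fun j => ∑' k, r (j + k), hs fun k => r (0 + k)]
  have e : ∀ j, ∑' k, r (j + 1 + k) = r (j + 1) + ∑' k, r (j + 1 + (k + 1)) := fun j =>
    hs fun k => r (j + 1 + k)
  simp only [e]
  rw [ENNReal.tsum_add]
  simp only [zero_add, add_zero]
  calc _ ≤ (1 + 2 : ℝ≥0∞) + (2 + 1) := by
        gcongr
        exact h1 0
    _ = 6 := by norm_num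

lemma IsStitchingTwo.tsum_le {g : ℝ → ℝ} (hg : IsStitchingTwo g) :
    ∑' j : ℕ, ∑' k : ℕ, ENNReal.ofReal (Real.exp 1 / g ((j + k : ℕ) : ℝ)) ≤ 6 := by
  have pos : ∀ n : ℕ, 0 < g n := fun n => zero_lt_one.trans_le (hg.one_le _ (Nat.cast_nonneg n))
  refine tsum_tsum_add_le_six (r := fun n => ENNReal.ofReal (Real.exp 1 / g n)) ?_ fun n => ?_
  · refine le_trans (le_of_eq ?_) hg.sum_le
    push_cast
    rfl
  · refine ENNReal.ofReal_le_ofReal (div_le_div_of_nonneg_left (Real.exp_pos _).le (pos 2) ?_)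
    rcases le_total n 2 with h | h
    · rw [hg.const n (Nat.cast_nonneg n) (by exact_mod_cast h)]; simp
    · exact hg.mono (Set.mem_Ici.2 (Nat.cast_nonneg _)) (Set.mem_Ici.2 (Nat.cast_nonneg _))
        (by exact_mod_cast h)

lemma IsStitchingTwo.exp_one_le {g : ℝ → ℝ} (hg : IsStitchingTwo g) (n : ℕ) :
    Real.exp 1 ≤ g n := by
  have pos : 0 < g 2 := zero_lt_one.trans_le (hg.one_le _ (by norm_num))
  have h2 : Real.exp 1 ≤ g 2 := by
    have h := ((ENNReal.le_tsum 0).trans (ENNReal.le_tsum 0)).trans hg.sum_le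
    rw [ENNReal.ofReal_le_one, Nat.cast_zero] at h
    norm_num at h
    rwa [div_le_one pos] at h
  refine h2.trans ?_
  rcases le_total n 2 with h | h
  · rw [hg.const n (Nat.cast_nonneg n) (by exact_mod_cast h)]
  · exact hg.mono (Set.mem_Ici.2 (by norm_num)) (Set.mem_Ici.2 (Nat.cast_nonneg _))
      (by exact_mod_cast h)

/-- The stitched exponents of all dyadic rectangles sum to a small failure probability. -/
lemma IsStitchingTwo.tsum_exp_le {g : ℝ → ℝ} (hg : IsStitchingTwo g) {δ : ℝ} (hδ0 : 0 < δ)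
    (hδ1 : δ < 1) :
    ∑' j : ℕ, ∑' k : ℕ, ENNReal.ofReal
      (16 * Real.exp (-4 * (Real.log (g ((j + k : ℕ) : ℝ)) + Real.log (2 / δ))))
      ≤ ENNReal.ofReal (δ / 2) := by
  have hterm : ∀ n : ℕ, ENNReal.ofReal
      (16 * Real.exp (-4 * (Real.log (g (n : ℝ)) + Real.log (2 / δ)))) ≤
      ENNReal.ofReal (δ / 12) * ENNReal.ofReal (Real.exp 1 / g n) := by
    intro n
    have he := hg.exp_one_le n
    have e2 : (2 : ℝ) ≤ Real.exp 1 := by linarith [Real.exp_one_gt_d9]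
    have hg0 : 0 < g n := (Real.exp_pos _).trans_le he
    rw [← ENNReal.ofReal_mul (by positivity)]
    refine ENNReal.ofReal_le_ofReal ?_
    rw [← Real.log_mul hg0.ne' (by positivity)]
    have : Real.exp (-4 * Real.log (g n * (2 / δ))) = (g n * (2 / δ))⁻¹ ^ 4 := by
      rw [show -4 * Real.log (g n * (2 / δ)) = ((4 : ℕ) : ℝ) * -Real.log (g n * (2 / δ)) by
        push_cast; ring, Real.exp_nat_mul, Real.exp_neg, Real.exp_log (by positivity)]
    rw [this]
    have h4 : (12 : ℝ) ≤ g n ^ 3 * Real.exp 1 := by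
      have e7 : (2.7 : ℝ) ≤ Real.exp 1 := by linarith [Real.exp_one_gt_d9]
      calc (12 : ℝ) ≤ 2.7 ^ 3 * 2.7 := by norm_num
        _ ≤ g n ^ 3 * Real.exp 1 := by
          gcongr
          exact e7.trans he
    have hδ3 : δ ^ 3 ≤ 1 := pow_le_one₀ hδ0.le hδ1.le
    have e : 16 * (g n * (2 / δ))⁻¹ ^ 4 = δ * (δ ^ 3 / g n ^ 4) := by
      field_simp
      norm_num
    have e' : δ / 12 * (Real.exp 1 / g n) = δ * (Real.exp 1 / (12 * g n)) := by
      field_simp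
    rw [e, e']
    refine mul_le_mul_of_nonneg_left ?_ hδ0.le
    rw [div_le_div_iff₀ (by positivity) (by positivity)]
    calc δ ^ 3 * (12 * g n) ≤ 1 * ((g n ^ 3 * Real.exp 1) * g n) := by gcongr
      _ = _ := by ring
  calc _ ≤ ∑' j : ℕ, ∑' k : ℕ, ENNReal.ofReal (δ / 12) *
        ENNReal.ofReal (Real.exp 1 / g ((j + k : ℕ) : ℝ)) :=
        ENNReal.tsum_le_tsum fun j => ENNReal.tsum_le_tsum fun k => hterm (j + k)
    _ ≤ ENNReal.ofReal (δ / 12) * 6 := by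
        simp only [ENNReal.tsum_mul_left]
        gcongr
        exact hg.tsum_le
    _ = _ := by
        rw [show (6 : ℝ≥0∞) = ENNReal.ofReal 6 by simp, ← ENNReal.ofReal_mul (by positivity)]
        congr 1
        ring

lemma exists_dyadic_block {t : ℕ} (ht : 1 ≤ t) :
    (2 ^ Nat.log 2 t ≤ t ∧ t < 2 * 2 ^ Nat.log 2 t) ∧ (Nat.log 2 t : ℝ) ≤ Real.logb 2 t ∧
      1 ≤ ⌈(t : ℝ) / 2⌉₊ ∧ ⌈(t : ℝ) / 2⌉₊ ≤ 2 ^ Nat.log 2 t := by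
  have ht0 : (0 : ℝ) < t := by exact_mod_cast ht
  have h1 : 2 ^ Nat.log 2 t ≤ t := Nat.pow_log_le_self 2 (by omega)
  have h2 : t < 2 * 2 ^ Nat.log 2 t := by
    have := Nat.lt_pow_succ_log_self (b := 2) (by norm_num) t
    rw [Nat.succ_eq_add_one, pow_succ] at this
    omega
  refine ⟨⟨h1, h2⟩, ?_, ?_, ?_⟩
  · rw [Real.le_logb_iff_rpow_le (by norm_num) ht0, Real.rpow_natCast]
    exact_mod_cast h1
  · exact Nat.one_le_iff_ne_zero.2 (Nat.ceil_pos.2 (by positivity)).ne'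
  · rw [Nat.ceil_le]
    have : (t : ℝ) ≤ 2 * 2 ^ Nat.log 2 t := by exact_mod_cast h2.le
    push_cast
    linarith

variable {α : Type*} [MeasurableSpace α] [MeasurableSingletonClass α]
  {c : α → α → ℝ≥0} {Δ : ℝ≥0}

/-- Time-uniform upper deviation of the cost between empirical measures from its mean at half the
sample sizes. -/
lemma measure_exists_empCost_gt_le (hc : Measurable (Function.uncurry c)) (hΔ : ∀ x y, c x y ≤ Δ)
    (P Q : Measure α) [IsProbabilityMeasure P] [IsProbabilityMeasure Q] {g : ℝ → ℝ}
    (hg : IsStitchingTwo g) {δ : ℝ} (hδ0 : 0 < δ) (hδ1 : δ < 1) {E : ℕ → ℕ → ℝ}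
    (hE : ∀ t s, E t s = ∫ z, empCost c t s z.1 z.2
      ∂((Measure.infinitePi fun _ : ℕ => P).prod (Measure.infinitePi fun _ : ℕ => Q))) :
    ((Measure.infinitePi fun _ : ℕ => P).prod (Measure.infinitePi fun _ : ℕ => Q))
      {z | ∃ t s : ℕ, 1 ≤ t ∧ 1 ≤ s ∧ 2 * Δ * Real.sqrt (((t : ℝ) + s) / (t * s) *
              (Real.log (g (Real.logb 2 t + Real.logb 2 s)) + Real.log (2 / δ)))
          < empCost c t s z.1 z.2 - E ⌈(t : ℝ) / 2⌉₊ ⌈(s : ℝ) / 2⌉₊}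
      ≤ ENNReal.ofReal (δ / 2) := by
  set ν := (Measure.infinitePi fun _ : ℕ => P).prod (Measure.infinitePi fun _ : ℕ => Q) with hν
  have E0 : ∀ t s, 0 ≤ E t s := fun t s => by
    rw [hE]; exact integral_nonneg fun z => empCost_nonneg _ _ _ _ _
  have Δ0 : (0 : ℝ) ≤ Δ := Δ.2
  rcases Δ0.eq_or_lt with hD0 | hD0
  · refine le_of_eq_of_le (b := 0) ?_ zero_le
    convert measure_empty (μ := ν)
    rw [Set.eq_empty_iff_forall_notMem]
    rintro z ⟨t, s, ht, hs, h⟩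
    rw [← hD0] at h
    have := empCost_le hΔ ht hs z.1 z.2
    rw [← hD0] at this
    simp only [mul_zero, zero_mul] at h
    linarith [E0 ⌈(t : ℝ) / 2⌉₊ ⌈(s : ℝ) / 2⌉₊]
  have hlog : 0 ≤ Real.log (2 / δ) := Real.log_nonneg (by rw [le_div_iff₀ hδ0]; linarith)
  set L : ℕ → ℝ := fun k => Real.log (g k) + Real.log (2 / δ) with hL
  have hg1 : ∀ k : ℕ, 1 ≤ g k := fun k => hg.one_le _ (Nat.cast_nonneg k)
  have hL0 : ∀ k, 0 ≤ L k := fun k => add_nonneg (Real.log_nonneg (hg1 k)) hlog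
  set σ : ℕ → ℕ → ℝ := fun j k => 1 / ((2 ^ j : ℕ) : ℝ) + 1 / ((2 ^ k : ℕ) : ℝ) with hσ
  have σ0 : ∀ j k, 0 < σ j k := fun j k => by positivity
  set u : ℕ → ℕ → ℝ := fun j k => 2 * Δ * Real.sqrt (σ j k / 2 * L (j + k)) with hu
  set B : ℕ → ℕ → Set ((ℕ → α) × (ℕ → α)) := fun j k =>
    {z | ∃ t s, (2 ^ j ≤ t ∧ t < 2 * 2 ^ j) ∧ (2 ^ k ≤ s ∧ s < 2 * 2 ^ k) ∧
      u j k ≤ empCost c t s z.1 z.2 - E (2 ^ j) (2 ^ k)} with hB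
  have hBk : ∀ j k, ν (B j k) ≤ ENNReal.ofReal
      (16 * Real.exp (-4 * (Real.log (g ((j + k : ℕ) : ℝ)) + Real.log (2 / δ)))) := by
    intro j k
    have u0 : 0 ≤ u j k := by positivity
    have h := measureReal_exists_empCost_le hc hΔ P Q (a := 2 ^ j) (b := 2 ^ k) Nat.one_le_two_pow
      Nat.one_le_two_pow (r := 4 * u j k / (Δ ^ 2 * σ j k))
      (div_nonneg (by linarith) (mul_nonneg (sq_nonneg _) (σ0 j k).le)) (u j k) (hE _ _)
    rw [← ofReal_measureReal]
    refine ENNReal.ofReal_le_ofReal (h.trans (le_of_eq ?_))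
    congr 2
    have usq : u j k ^ 2 = 2 * Δ ^ 2 * σ j k * L (j + k) := by
      simp only [hu]
      rw [mul_pow, Real.sq_sqrt (mul_nonneg (by linarith [σ0 j k]) (hL0 _))]
      ring
    have hs0 := (σ0 j k).ne'
    have hΔ0 := hD0.ne'
    change -(4 * u j k / (Δ ^ 2 * σ j k) * u j k) +
      (4 * u j k / (Δ ^ 2 * σ j k)) ^ 2 * Δ ^ 2 * σ j k / 8 = -4 * L (j + k)
    have e : -(4 * u j k / (Δ ^ 2 * σ j k) * u j k) +
      (4 * u j k / (Δ ^ 2 * σ j k)) ^ 2 * Δ ^ 2 * σ j k / 8 =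
        -(2 * u j k ^ 2 / (Δ ^ 2 * σ j k)) := by
      field_simp
      ring
    rw [e, usq]
    field_simp
    ring
  have hsub : {z : (ℕ → α) × (ℕ → α) | ∃ t s : ℕ, 1 ≤ t ∧ 1 ≤ s ∧
      2 * Δ * Real.sqrt (((t : ℝ) + s) / (t * s) *
              (Real.log (g (Real.logb 2 t + Real.logb 2 s)) + Real.log (2 / δ)))
          < empCost c t s z.1 z.2 - E ⌈(t : ℝ) / 2⌉₊ ⌈(s : ℝ) / 2⌉₊} ⊆ ⋃ j, ⋃ k, B j k := by
    rintro z ⟨t, s, ht, hs, h⟩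
    obtain ⟨t1, t2, t3, t4⟩ := exists_dyadic_block ht
    obtain ⟨s1, s2, s3, s4⟩ := exists_dyadic_block hs
    have ht0 : (0 : ℝ) < t := by exact_mod_cast ht
    have hs0 : (0 : ℝ) < s := by exact_mod_cast hs
    set j := Nat.log 2 t
    set k := Nat.log 2 s
    have hmonoE : E (2 ^ j) (2 ^ k) ≤ E ⌈(t : ℝ) / 2⌉₊ ⌈(s : ℝ) / 2⌉₊ := by
      rw [hE, hE]
      exact integral_empCost_antitone hc hΔ (isExchangeable_infinitePi P)
        (isExchangeable_infinitePi Q) t3 s3 t4 s4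
    refine Set.mem_iUnion₂.2 ⟨j, k, t, s, t1, s1, ?_⟩
    refine le_trans ?_ (h.le.trans (sub_le_sub_left hmonoE _))
    refine mul_le_mul_of_nonneg_left (Real.sqrt_le_sqrt ?_) (by positivity)
    have hcast : ((j + k : ℕ) : ℝ) ≤ Real.logb 2 t + Real.logb 2 s := by
      push_cast; exact add_le_add t2 s2
    have hmon : g ((j + k : ℕ) : ℝ) ≤ g (Real.logb 2 t + Real.logb 2 s) :=
      hg.mono (Set.mem_Ici.2 (Nat.cast_nonneg _))
        (Set.mem_Ici.2 ((Nat.cast_nonneg _).trans hcast)) hcast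
    refine mul_le_mul ?_ (add_le_add (Real.log_le_log (by linarith [hg1 (j + k)]) hmon) le_rfl)
      (hL0 _) (by positivity)
    have e : ((t : ℝ) + s) / (t * s) = 1 / t + 1 / s := by field_simp; ring
    have q1 : 1 / ((2 ^ j : ℕ) : ℝ) / 2 ≤ 1 / t := by
      rw [div_div]
      refine one_div_le_one_div_of_le ht0 ?_
      rw [mul_comm]; exact_mod_cast t1.2.le
    have q2 : 1 / ((2 ^ k : ℕ) : ℝ) / 2 ≤ 1 / s := by
      rw [div_div]
      refine one_div_le_one_div_of_le hs0 ?_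
      rw [mul_comm]; exact_mod_cast s1.2.le
    rw [e]
    simp only [hσ]
    linarith
  calc _ ≤ ν (⋃ j, ⋃ k, B j k) := measure_mono hsub
    _ ≤ ∑' j, ∑' k, ν (B j k) :=
        (measure_iUnion_le _).trans (ENNReal.tsum_le_tsum fun j => measure_iUnion_le _)
    _ ≤ _ := ENNReal.tsum_le_tsum fun j => ENNReal.tsum_le_tsum fun k => hBk j k
    _ ≤ _ := hg.tsum_exp_le hδ0 hδ1

end StitchedUpperDeviation

section StitchedLowerDeviation

variable {α : Type*} [MeasurableSpace α] [MeasurableSingletonClass α]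
  {c : α → α → ℝ≥0} {Δ : ℝ≥0}

lemma measure_exists_empCost_lt_sub_le (hc : Measurable (Function.uncurry c))
    (hΔ : ∀ x y, c x y ≤ Δ) (P Q : Measure α) [IsProbabilityMeasure P] [IsProbabilityMeasure Q]
    {l : ℝ → ℝ} (hl : IsStitchingOne l) {δ : ℝ} (hδ0 : 0 < δ) (hδ1 : δ < 1) {ε : ℝ} (hε : 0 < ε) :
    ((Measure.infinitePi fun _ : ℕ => P).prod (Measure.infinitePi fun _ : ℕ => Q))
      {z | ∃ t s : ℕ, 1 ≤ t ∧ 1 ≤ s ∧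
        Δ * kappaTwo l δ t s + ε < (otCost c P Q).toReal - empCost c t s z.1 z.2}
      ≤ ENNReal.ofReal (δ / 2) := by
  set ν₁ := Measure.infinitePi fun _ : ℕ => P with hν₁
  set ν₂ := Measure.infinitePi fun _ : ℕ => Q with hν₂
  obtain ⟨f, g, M, mf, mg, hf, hg, hfg, hv⟩ := exists_bounded_potentials hc hΔ
    (v := (otCost c P Q).toReal - ε) (P := P) (Q := Q) (by linarith)
  have hA₁ := measure_exists_average_gt_le P mf (m := M - Δ) (D := Δ) Δ.2
    (fun x => by simpa using hf x) hl hδ0 hδ1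
  have hA₂ := measure_exists_average_gt_le Q mg (m := -M) (D := Δ) Δ.2
    (fun x => by rw [neg_add_eq_sub]; exact hg x) hl hδ0 hδ1
  set A₁ := {x : ℕ → α | ∃ t : ℕ, 1 ≤ t ∧
      Δ * kappaOne l δ t < ∫ e, f e ∂P - (∑ i ∈ Finset.range t, f (x i)) / t}
  set A₂ := {x : ℕ → α | ∃ t : ℕ, 1 ≤ t ∧
      Δ * kappaOne l δ t < ∫ e, g e ∂Q - (∑ i ∈ Finset.range t, g (x i)) / t}
  have hN : ∀ᵐ z ∂(ν₁.prod ν₂), ∀ i j, f (z.1 i) + g (z.2 j) ≤ c (z.1 i) (z.2 j) := by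
    rw [ae_all_iff]; intro i
    rw [ae_all_iff]; intro j
    exact ((measurePreserving_eval_infinitePi (fun _ : ℕ => P) i).prod
      (measurePreserving_eval_infinitePi (fun _ : ℕ => Q) j)).quasiMeasurePreserving.ae hfg
  set N := {z : (ℕ → α) × (ℕ → α) | ¬ ∀ i j, f (z.1 i) + g (z.2 j) ≤ c (z.1 i) (z.2 j)}
  have hsub : {z : (ℕ → α) × (ℕ → α) | ∃ t s : ℕ, 1 ≤ t ∧ 1 ≤ s ∧
      Δ * kappaTwo l δ t s + ε < (otCost c P Q).toReal - empCost c t s z.1 z.2} ⊆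
      A₁ ×ˢ Set.univ ∪ Set.univ ×ˢ A₂ ∪ N := by
    rintro z ⟨t, s, ht, hs, h⟩
    by_contra hcon
    simp only [Set.mem_union, Set.mem_prod, Set.mem_univ, and_true, true_and, not_or] at hcon
    obtain ⟨⟨h1, h2⟩, h3⟩ := hcon
    have h3' : ∀ i j, f (z.1 i) + g (z.2 j) ≤ c (z.1 i) (z.2 j) := not_not.1 h3
    have h1' := not_lt.1 fun h => h1 ⟨t, ht, h⟩
    have h2' := not_lt.1 fun h => h2 ⟨s, hs, h⟩
    have h4 := le_otCost_empMeasure hc hΔ ht hs h3'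
    rw [kappaTwo, mul_add] at h
    simp only [empCost] at h
    linarith
  calc _ ≤ (ν₁.prod ν₂) (A₁ ×ˢ Set.univ) + (ν₁.prod ν₂) (Set.univ ×ˢ A₂) + (ν₁.prod ν₂) N :=
        (measure_mono hsub).trans ((measure_union_le _ _).trans
          (add_le_add_left (measure_union_le _ _) _))
    _ ≤ ENNReal.ofReal (δ / 4) + ENNReal.ofReal (δ / 4) + 0 := by
        gcongr
        · rw [Measure.prod_prod]; simpa using hA₁
        · rw [Measure.prod_prod]; simpa using hA₂
        · exact le_of_eq (ae_iff.1 hN)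
    _ = _ := by
        rw [add_zero, ← ENNReal.ofReal_add (by positivity) (by positivity)]
        congr 1
        ring

/-- Time-uniform lower deviation of the cost between empirical measures from the population cost. -/
lemma measure_exists_empCost_lt_le (hc : Measurable (Function.uncurry c))
    (hΔ : ∀ x y, c x y ≤ Δ) (P Q : Measure α) [IsProbabilityMeasure P] [IsProbabilityMeasure Q]
    {l : ℝ → ℝ} (hl : IsStitchingOne l) {δ : ℝ} (hδ0 : 0 < δ) (hδ1 : δ < 1) :
    ((Measure.infinitePi fun _ : ℕ => P).prod (Measure.infinitePi fun _ : ℕ => Q))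
      {z | ∃ t s : ℕ, 1 ≤ t ∧ 1 ≤ s ∧
        Δ * kappaTwo l δ t s < (otCost c P Q).toReal - empCost c t s z.1 z.2}
      ≤ ENNReal.ofReal (δ / 2) := by
  set ν := (Measure.infinitePi fun _ : ℕ => P).prod (Measure.infinitePi fun _ : ℕ => Q)
  set B : ℕ → Set ((ℕ → α) × (ℕ → α)) := fun n => {z | ∃ t s : ℕ, 1 ≤ t ∧ 1 ≤ s ∧
    Δ * kappaTwo l δ t s + 1 / ((n : ℝ) + 1) < (otCost c P Q).toReal - empCost c t s z.1 z.2}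
  have hB : Monotone B := by
    rintro n m hnm z ⟨t, s, ht, hs, h⟩
    refine ⟨t, s, ht, hs, lt_of_le_of_lt ?_ h⟩
    have := Nat.one_div_le_one_div (α := ℝ) hnm
    linarith
  have hsub : {z : (ℕ → α) × (ℕ → α) | ∃ t s : ℕ, 1 ≤ t ∧ 1 ≤ s ∧
      Δ * kappaTwo l δ t s < (otCost c P Q).toReal - empCost c t s z.1 z.2} ⊆ ⋃ n, B n := by
    rintro z ⟨t, s, ht, hs, h⟩
    obtain ⟨n, hn⟩ := exists_nat_one_div_lt (sub_pos.2 h)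
    exact Set.mem_iUnion.2 ⟨n, t, s, ht, hs, by linarith⟩
  refine (measure_mono hsub).trans ?_
  rw [hB.measure_iUnion]
  exact iSup_le fun n => measure_exists_empCost_lt_sub_le hc hΔ P Q hl hδ0 hδ1 (by positivity)

end StitchedLowerDeviation

lemma map_prodMk_eq_prod_infinitePi {α Ω : Type*} [MeasurableSpace α] [MeasurableSpace Ω]
    {μ : Measure Ω} [IsProbabilityMeasure μ] {P Q : Measure α} {X Y : ℕ → Ω → α}
    (hXm : ∀ i, Measurable (X i)) (hYm : ∀ j, Measurable (Y j))
    (hXP : ∀ i, μ.map (X i) = P) (hYQ : ∀ j, μ.map (Y j) = Q)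
    (hX : iIndepFun X μ) (hY : iIndepFun Y μ)
    (hXY : IndepFun (fun ω i => X i ω) (fun ω j => Y j ω) μ) :
    μ.map (fun ω => ((fun i => X i ω), fun j => Y j ω)) =
      (Measure.infinitePi fun _ : ℕ => P).prod (Measure.infinitePi fun _ : ℕ => Q) := by
  have h := (indepFun_iff_map_prod_eq_prod_map_map (measurable_pi_lambda _ hXm).aemeasurable
    (measurable_pi_lambda _ hYm).aemeasurable).1 hXY
  rw [h, hX.map_fun_eq_infinitePi_map hXm, hY.map_fun_eq_infinitePi_map hYm]
  simp only [hXP, hYQ]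

theorem corollary4p4 {d : ℕ} (𝒳 : Set (EuclideanSpace ℝ (Fin d)))
    (P Q : Measure 𝒳) [IsProbabilityMeasure P] [IsProbabilityMeasure Q]
    {Ω : Type*} [MeasurableSpace Ω] (μ : Measure Ω) [IsProbabilityMeasure μ]
    -- independent sequences of i.i.d. observations from `P` and `Q`
    (X Y : ℕ → Ω → 𝒳)
    (hXm : ∀ i, Measurable (X i)) (hYm : ∀ j, Measurable (Y j))
    (hXP : ∀ i, μ.map (X i) = P) (hYQ : ∀ j, μ.map (Y j) = Q)
    (hX : iIndepFun X μ) (hY : iIndepFun Y μ)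
    (hXY : IndepFun (fun ω i => X i ω) (fun ω j => Y j ω) μ)
    -- the cost function
    (c : 𝒳 → 𝒳 → ℝ≥0) (hc : LowerSemicontinuous fun z : 𝒳 × 𝒳 => c z.1 z.2)
    (Δ : ℝ) (hΔ : ∀ x y, (c x y : ℝ) ≤ Δ)
    -- upper bound on the bias of the plug-in estimator
    (α : ℕ → ℕ → ℝ)
    (hα : ∀ t s : ℕ, 1 ≤ t → 1 ≤ s →
      (∫ ω, (otCost c (empMeasure (fun i => X i ω) t) (empMeasure (fun j => Y j ω) s)).toReal ∂μ)
        - (otCost c P Q).toReal ≤ α t s)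
    -- stitching functions
    (l g : ℝ → ℝ) (hl : IsStitchingOne l) (hg : IsStitchingTwo g)
    (δ : ℝ) (hδ0 : 0 < δ) (hδ1 : δ < 1) :
    ENNReal.ofReal (1 - δ) ≤ μ {ω | ∀ t s : ℕ, 1 ≤ t → 1 ≤ s →
      - α ⌈(t : ℝ) / 2⌉₊ ⌈(s : ℝ) / 2⌉₊
          - 2 * Δ * Real.sqrt (((t : ℝ) + s) / (t * s) *
              (Real.log (g (Real.logb 2 t + Real.logb 2 s)) + Real.log (2 / δ)))
        ≤ (otCost c P Q).toReal
          - (otCost c (empMeasure (fun i => X i ω) t) (empMeasure (fun j => Y j ω) s)).toReal ∧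
      (otCost c P Q).toReal
          - (otCost c (empMeasure (fun i => X i ω) t) (empMeasure (fun j => Y j ω) s)).toReal
        ≤ Δ * kappaTwo l δ t s} := by
  set ν := (Measure.infinitePi fun _ : ℕ => P).prod (Measure.infinitePi fun _ : ℕ => Q) with hν
  set Z : Ω → (ℕ → 𝒳) × (ℕ → 𝒳) := fun ω => ((fun i => X i ω), fun j => Y j ω) with hZ
  have mZ : Measurable Z := (measurable_pi_lambda _ hXm).prodMk (measurable_pi_lambda _ hYm)
  have hmap : μ.map Z = ν := map_prodMk_eq_prod_infinitePi hXm hYm hXP hYQ hX hY hXY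
  have hcm : Measurable (Function.uncurry c) := hc.measurable
  obtain ⟨x₀⟩ : Nonempty 𝒳 := nonempty_of_isProbabilityMeasure P
  lift Δ to ℝ≥0 using (NNReal.coe_nonneg _).trans (hΔ x₀ x₀)
  have hΔ' : ∀ x y, c x y ≤ Δ := fun x y => by exact_mod_cast hΔ x y
  set E : ℕ → ℕ → ℝ := fun t s => ∫ z, empCost c t s z.1 z.2 ∂ν with hE
  have hαE : ∀ t s, 1 ≤ t → 1 ≤ s → E t s - (otCost c P Q).toReal ≤ α t s := by
    intro t s ht hs
    have := hα t s ht hs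
    have e : E t s = ∫ ω, (otCost c (empMeasure (fun i => X i ω) t)
        (empMeasure (fun j => Y j ω) s)).toReal ∂μ := by
      simp only [hE]
      rw [← hmap, integral_map mZ.aemeasurable (measurable_empCost hcm ht s).aestronglyMeasurable]
      rfl
    rwa [e]
  have hup := measure_exists_empCost_gt_le hcm hΔ' P Q hg hδ0 hδ1 (E := E) fun _ _ => rfl
  have hlow := measure_exists_empCost_lt_le hcm hΔ' P Q hl hδ0 hδ1
  rw [← hν, ← hmap] at hup hlow
  have hup' := (Measure.le_map_apply mZ.aemeasurable _).trans hup
  have hlow' := (Measure.le_map_apply mZ.aemeasurable _).trans hlow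
  set S := {ω | ∀ t s : ℕ, 1 ≤ t → 1 ≤ s →
      - α ⌈(t : ℝ) / 2⌉₊ ⌈(s : ℝ) / 2⌉₊
          - 2 * Δ * Real.sqrt (((t : ℝ) + s) / (t * s) *
              (Real.log (g (Real.logb 2 t + Real.logb 2 s)) + Real.log (2 / δ)))
        ≤ (otCost c P Q).toReal
          - (otCost c (empMeasure (fun i => X i ω) t) (empMeasure (fun j => Y j ω) s)).toReal ∧
      (otCost c P Q).toReal
          - (otCost c (empMeasure (fun i => X i ω) t) (empMeasure (fun j => Y j ω) s)).toReal
        ≤ Δ * kappaTwo l δ t s} with hS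
  have hcompl : μ Sᶜ ≤ ENNReal.ofReal δ := by
    refine (measure_mono (t := _ ∪ _) fun ω hω => ?_).trans ((measure_union_le _ _).trans
      ((add_le_add hup' hlow').trans (le_of_eq ?_)))
    · simp only [hS, Set.mem_compl_iff, Set.mem_ofPred_eq, not_forall] at hω
      obtain ⟨t, s, ht, hs, h⟩ := hω
      rcases not_and_or.1 h with h | h
      · refine Or.inl ⟨t, s, ht, hs, ?_⟩
        have h1 := hαE _ _ (exists_dyadic_block ht).2.2.1 (exists_dyadic_block hs).2.2.1
        have h2 : empCost c t s (Z ω).1 (Z ω).2 = (otCost c (empMeasure (fun i => X i ω) t)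
          (empMeasure (fun j => Y j ω) s)).toReal := rfl
        rw [h2]
        linarith [not_le.1 h]
      · exact Or.inr ⟨t, s, ht, hs, not_le.1 h⟩
    · rw [← ENNReal.ofReal_add (by positivity) (by positivity), add_halves]
  have hone : (1 : ℝ≥0∞) ≤ μ S + μ Sᶜ := by
    rw [← measure_univ (μ := μ), ← Set.union_compl_self S]
    exact measure_union_le _ _
  rw [ENNReal.ofReal_sub _ hδ0.le, ENNReal.ofReal_one]
  exact tsub_le_iff_right.2 (hone.trans (add_le_add_right hcompl _))
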